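/- Real random variables $S,T$ are called FKG if $\mathrm{Cov}(F(S,T),G(S,T))\ge 0$ for all measurable, coordinatewise non-decreasing functions $F,G:\mathbb{R}^2\to\mathbb{R}$ with $F(S,T),G(S,T)\in L^2$. For a random variable $U$ with smooth density $f$, let $\rho_U=f'/f$ be its score function and $J(U)=\mathbb{E}\,\rho_U(U)^2$ its Fisher information. For random variables $X,Y$ and $\beta\in[0,1]$ let $$\Delta(X,Y,\beta)=\mathbb{E}\Bigl(\sqrt{\beta}\,\rho_X(X)+\sqrt{1-\beta}\,\rho_Y(Y)-\widetilde\rho\bigl(\sqrt{\beta}X+\sqrt{1-\beta}\,Y\bigr)\Bigr)^2,$$ where $\widetilde\rho$ is the score function of $\sqrt{\beta}X+\sqrt{1-\beta}\,Y$. Let $K\in\mathbb{R}$ and $\tau>0$. Let $S,T$ be FKG random variables with mean zero and (finite) variances at most $K$, let $Z_S,Z_T$ be $N(0,\tau)$ random variables (that is, of variance $\tau$) that are independent of $(S,T)$ and of each other, and put $X=S+Z_S$, $Y=T+Z_T$. Then for every $\beta\in[0,1]$ the variables $X$, $Y$ and $\sqrt\beta X+\sqrt{1-\beta}\,Y$ have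 smooth densities and finite Fisher information, and the following hold. (i) For every $\epsilon>0$ there is a constant $C=C(K,\tau,\epsilon)$ such that for all such $S,T,Z_S,Z_T$ and all $\beta\in[0,1]$ $$\beta J(X)+(1-\beta)J(Y)-J\bigl(\sqrt{\beta}X+\sqrt{1-\beta}\,Y\bigr)+C\,\mathrm{Cov}(S,T)^{1/3-\epsilon}\ \ge\ \Delta(X,Y,\beta).$$ (ii) For every $\epsilon>0$, $\delta>0$ and $L$ there is a constant $C=C(K,\tau,\epsilon,\delta,L)$ such that for all such $S,T,Z_S,Z_T$ which satisfy in addition $\mathbb{E}|S|^{2+\delta}\le L$ and $\mathbb{E}|T|^{2+\delta}\le L$, and all $\beta\in[0,1]$, $$\beta J(X)+(1-\beta)J(Y)-J\bigl(\sqrt{\beta}X+\sqrt{1-\beta}\,Y\bigr)+C\,\mathrm{Cov}(S,T)^{\frac{2+\delta}{6+\delta}-\epsilon}\ \ge\ \Delta(X,Y,\beta).$$ (Here a zero covariance raised to a negative power is read as $0$.) -/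

import Mathlib

open MeasureTheory ProbabilityTheory
open scoped NNReal ENNReal

universe u

noncomputable section

namespace FKGFisher

/-- The random variables `X 0, …, X (m - 1)` are FKG: increasing functions of them have
non-negative covariance, whenever these functions are measurable and square integrable,
so that the covariance exists. -/
def IsFKG {Ω : Type*} [MeasurableSpace Ω] {m : ℕ} (X : Fin m → Ω → ℝ) (μ : Measure Ω) : Prop :=
  ∀ F G : (Fin m → ℝ) → ℝ, Monotone F → Monotone G → Measurable F → Measurable G →
    MemLp (fun ω => F (fun i => X i ω)) 2 μ → MemLp (fun ω => G (fun i => X i ω)) 2 μ →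
      0 ≤ cov[fun ω => F (fun i => X i ω), fun ω => G (fun i => X i ω); μ]

/-- `f` is a smooth density of the random variable `U` with respect to Lebesgue measure. -/
structure IsSmoothDensity {Ω : Type*} [MeasurableSpace Ω] (f : ℝ → ℝ) (U : Ω → ℝ)
    (μ : Measure Ω) : Prop where
  smooth : ContDiff ℝ (⊤ : ℕ∞) f
  nonneg : ∀ u, 0 ≤ f u
  hasLaw : HasLaw U (volume.withDensity fun u => ENNReal.ofReal (f u)) μ

open Classical in
/-- The smooth density of `U` (it is unique if it exists), and `0` if there is none. -/
def density {Ω : Type*} [MeasurableSpace Ω] (U : Ω → ℝ) (μ : Measure Ω) : ℝ → ℝ :=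
  if h : ∃ f, IsSmoothDensity f U μ then h.choose else 0

/-- The score function `ρ = f' / f` of `U`, where `f` is the density of `U`. -/
def score {Ω : Type*} [MeasurableSpace Ω] (U : Ω → ℝ) (μ : Measure Ω) (u : ℝ) : ℝ :=
  deriv (density U μ) u / density U μ u

/-- The Fisher information `J(U) = 𝔼 ρ(U)²`. -/
def fisherInfo {Ω : Type*} [MeasurableSpace Ω] (U : Ω → ℝ) (μ : Measure Ω) : ℝ :=
  ∫ ω, score U μ (U ω) ^ 2 ∂μ

/-- `U` has a smooth density and finite Fisher information. -/
def HasFiniteFisherInfo {Ω : Type*} [MeasurableSpace Ω] (U : Ω → ℝ) (μ : Measure Ω) : Prop :=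
  (∃ f, IsSmoothDensity f U μ) ∧ MemLp (fun ω => score U μ (U ω)) 2 μ

/-- The combination `√β X + √(1 - β) Y`. -/
def mix {Ω : Type*} (X Y : Ω → ℝ) (β : ℝ) (ω : Ω) : ℝ :=
  √β * X ω + √(1 - β) * Y ω

/-- `Δ(X, Y, β) = 𝔼 (√β ρ_X(X) + √(1 - β) ρ_Y(Y) - ρ̃(√β X + √(1 - β) Y))²`, where `ρ̃` is the
score function of `√β X + √(1 - β) Y`. -/
def scoreGap {Ω : Type*} [MeasurableSpace Ω] (X Y : Ω → ℝ) (β : ℝ) (μ : Measure Ω) : ℝ :=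
  ∫ ω, (√β * score X μ (X ω) + √(1 - β) * score Y μ (Y ω)
    - score (mix X Y β) μ (mix X Y β ω)) ^ 2 ∂μ

/-- `S`, `T` are FKG with mean zero and (finite) variance at most `K`, and `ZS`, `ZT` are
`N(0, τ)` variables which are independent of `(S, T)` and of each other. -/
structure IsFKGPairWithNoise {Ω : Type*} [MeasurableSpace Ω] (S T ZS ZT : Ω → ℝ)
    (K : ℝ) (τ : ℝ≥0) (μ : Measure Ω) : Prop where
  fkg : IsFKG ![S, T] μ
  memLp_S : MemLp S 2 μ
  memLp_T : MemLp T 2 μ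
  mean_S : μ[S] = 0
  mean_T : μ[T] = 0
  var_S : Var[S; μ] ≤ K
  var_T : Var[T; μ] ≤ K
  law_ZS : HasLaw ZS (gaussianReal 0 τ) μ
  law_ZT : HasLaw ZT (gaussianReal 0 τ) μ
  indep_noise : IndepFun ZS ZT μ
  indep : IndepFun (fun ω => (S ω, T ω)) (fun ω => (ZS ω, ZT ω)) μ

end FKGFisher

end

/-! Write `a = √β`, `b = √(1 - β)`, `W = a X + b Y`. The score of a variable smoothed by Gaussian
noise is a conditional expectation of the noise: `ρ_X(X) = 𝔼[-Z_S / τ | X]`, and likewise for `Y`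
and for `W`, whose noise `a Z_S + b Z_T` is again `N(0, τ)`. Expanding the square in `Δ` with these
orthogonality relations shows that `Δ` equals `β J(X) + (1 - β) J(Y) - J(W)` up to two correlations
of the form `𝔼[k(X, Y) (ρ_X(X) + Z_S / τ)]` and its mirror image (`scoreGap_eq`). Both would vanish
if `S` and `T` were independent.

In general such a correlation is `∫∫ k(x, y) 𝔼[g_x(S) φ(y - T)] dx dy`, where `φ` is the Gaussian
density and `g_x(s) = φ(x - s) (ρ_X(x) + (x - s) / τ)`. Since `g_x(S)` has mean zero, the inner
expectation is a covariance of Lipschitz functions of `S` and `T`, which Newman's inequality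
(`IsFKG.abs_covariance_le`) bounds by a multiple of `Cov(S, T)`.

The integral over the plane is truncated to a box of half-width `B`. Scores grow at most linearly
(`IsNoisy.abs_score_le`), so the box contributes at most a constant times `(1 + B)^4 Cov(S, T)`: one
power from `k`, one from the Lipschitz constant of `g_x`, two from the area. Outside the box,
moments of order `r` of `S`, `T` and high moments of the scores, all bounded by Gaussian moments,
give almost `B^(-r)`. Taking `B = Cov(S, T)^(-1 / (4 + r))` yields the exponent `r / (4 + r) - ε`,
with `r = 2` and `r = 2 + δ` for the two claims. -/

noncomputable section

namespace FKGFisher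

/-! ### Gaussian convolutions: bounds, smoothness, positivity. -/

open Polynomial in
/-- A polynomial times the density of the centred Gaussian law of variance `τ`. -/
def gaussMoment (τ : ℝ≥0) (P : ℝ[X]) (z : ℝ) : ℝ := P.eval z * gaussianPDFReal 0 τ z

/-- The convolution of `gaussMoment τ P` with the measure `ν`. -/
def smoothed (τ : ℝ≥0) (ν : Measure ℝ) (P : Polynomial ℝ) (x : ℝ) : ℝ :=
  ∫ u, gaussMoment τ P (x - u) ∂ν

open Polynomial in
/-- The polynomial of the derivative of `gaussMoment τ P`. -/
def gaussDeriv (τ : ℝ≥0) (P : ℝ[X]) : ℝ[X] := derivative P - C (τ : ℝ)⁻¹ * (X * P)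

lemma hasDerivAt_gaussianPDFReal (τ : ℝ≥0) (z : ℝ) :
    HasDerivAt (gaussianPDFReal 0 τ) (-(τ : ℝ)⁻¹ * z * gaussianPDFReal 0 τ z) z := by
  rw [gaussianPDFReal_def]
  have h1 : HasDerivAt (fun x : ℝ => -(x - 0) ^ 2 / (2 * (τ : ℝ))) (-(τ : ℝ)⁻¹ * z) z := by
    have := (((hasDerivAt_id z).sub_const 0).pow 2).neg.div_const (2 * (τ : ℝ))
    refine this.congr_deriv ?_
    simp only [id]
    by_cases h : (τ : ℝ) = 0
    · simp [h]
    · field_simp; ring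
  exact (h1.exp.const_mul _).congr_deriv (by ring)

lemma hasDerivAt_gaussMoment (τ : ℝ≥0) (P : Polynomial ℝ) (z : ℝ) :
    HasDerivAt (gaussMoment τ P) (gaussMoment τ (gaussDeriv τ P) z) z := by
  refine ((P.hasDerivAt z).mul (hasDerivAt_gaussianPDFReal τ z)).congr_deriv ?_
  simp [gaussMoment, gaussDeriv]
  ring

lemma continuous_gaussMoment (τ : ℝ≥0) (P : Polynomial ℝ) : Continuous (gaussMoment τ P) :=
  continuous_iff_continuousAt.2 fun z => (hasDerivAt_gaussMoment τ P z).continuousAt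

/-- For a monomial, `t ^ n / n! ≤ exp t` at `t = z² / (2τ)` controls the even power `z ^ (2n)`
against the Gaussian, and `|z| ^ n ≤ 1 + z ^ (2n)` reduces to it. -/
lemma exists_bound_gaussMoment {τ : ℝ≥0} (hτ : 0 < τ) (P : Polynomial ℝ) :
    ∃ C, 0 ≤ C ∧ ∀ z, |gaussMoment τ P z| ≤ C := by
  have hτ' : (0 : ℝ) < τ := hτ
  induction P using Polynomial.induction_on' with
  | add p q hp hq =>
    obtain ⟨C, hC, h⟩ := hp
    obtain ⟨D, hD, h'⟩ := hq
    refine ⟨C + D, by positivity, fun z => ?_⟩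
    have : gaussMoment τ (p + q) z = gaussMoment τ p z + gaussMoment τ q z := by
      simp [gaussMoment]; ring
    rw [this]
    exact (abs_add_le _ _).trans (add_le_add (h z) (h' z))
  | monomial n a =>
    set k := (√(2 * Real.pi * τ))⁻¹ with hk
    have hk0 : 0 ≤ k := by positivity
    refine ⟨|a| * ((1 + (2 * τ) ^ n * n.factorial) * k), by positivity, fun z => ?_⟩
    simp only [gaussMoment, Polynomial.eval_monomial, gaussianPDFReal, sub_zero, ← hk]
    set e := Real.exp (-z ^ 2 / (2 * τ)) with he
    have he0 : 0 < e := Real.exp_pos _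
    have he1 : e ≤ 1 := Real.exp_le_one_iff.2 (by
      rw [neg_div]; exact neg_nonpos.2 (by positivity))
    have h1 := Real.pow_div_factorial_le_exp (x := z ^ 2 / (2 * τ)) (by positivity) n
    have h2 : Real.exp (z ^ 2 / (2 * τ)) * e = 1 := by
      rw [he, ← Real.exp_add]; simp [neg_div]
    have h3 : (z ^ 2) ^ n * e ≤ (2 * τ) ^ n * n.factorial := by
      rw [div_pow, div_div, div_le_iff₀ (by positivity)] at h1
      calc (z ^ 2) ^ n * e ≤ (Real.exp (z ^ 2 / (2 * τ)) * ((2 * τ) ^ n * n.factorial)) * e := by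
            gcongr
        _ = (Real.exp (z ^ 2 / (2 * τ)) * e) * ((2 * τ) ^ n * n.factorial) := by ring
        _ = _ := by rw [h2, one_mul]
    have h4 : |z| ^ n ≤ 1 + (z ^ 2) ^ n := by
      have : (z ^ 2) ^ n = (|z| ^ n) ^ 2 := by rw [← sq_abs]; ring
      rw [this]; nlinarith [sq_nonneg (|z| ^ n - 1), sq_nonneg (|z| ^ n)]
    rw [abs_mul, abs_mul, abs_mul, abs_pow, abs_of_nonneg hk0, abs_of_pos he0]
    have h5 : |z| ^ n * e ≤ 1 + (2 * τ) ^ n * n.factorial := by nlinarith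
    calc |a| * |z| ^ n * (k * e) = |a| * ((|z| ^ n * e) * k) := by ring
      _ ≤ _ := by gcongr

lemma integrable_gaussMoment_sub {τ : ℝ≥0} (hτ : 0 < τ) (ν : Measure ℝ) [IsFiniteMeasure ν]
    (P : Polynomial ℝ) (x : ℝ) : Integrable (fun u => gaussMoment τ P (x - u)) ν := by
  obtain ⟨C, -, h⟩ := exists_bound_gaussMoment hτ P
  refine Integrable.of_bound (C := C) ?_ (.of_forall fun u => by simpa using h _)
  have := continuous_gaussMoment τ P
  exact (by fun_prop : Continuous fun u => gaussMoment τ P (x - u)).aestronglyMeasurable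

lemma hasDerivAt_smoothed {τ : ℝ≥0} (hτ : 0 < τ) (ν : Measure ℝ) [IsFiniteMeasure ν]
    (P : Polynomial ℝ) (x : ℝ) :
    HasDerivAt (smoothed τ ν P) (smoothed τ ν (gaussDeriv τ P) x) x := by
  obtain ⟨C, -, h⟩ := exists_bound_gaussMoment hτ (gaussDeriv τ P)
  refine (hasDerivAt_integral_of_dominated_loc_of_deriv_le (bound := fun _ => C)
    (F := fun x u => gaussMoment τ P (x - u)) (F' := fun x u => gaussMoment τ (gaussDeriv τ P) (x - u))
    Filter.univ_mem (.of_forall fun y => (integrable_gaussMoment_sub hτ ν P y).1)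
    (integrable_gaussMoment_sub hτ ν P x) (integrable_gaussMoment_sub hτ ν _ x).1
    (.of_forall fun u y _ => by simpa using h _) (integrable_const _)
    (.of_forall fun u y _ => ?_)).2
  simpa using (hasDerivAt_gaussMoment τ P (y - u)).comp_sub_const y u

/-- Differentiation only replaces the polynomial `P` by `gaussDeriv τ P`, so the induction runs over
all `P` at once. -/
lemma contDiff_smoothed {τ : ℝ≥0} (hτ : 0 < τ) (ν : Measure ℝ) [IsFiniteMeasure ν]
    (P : Polynomial ℝ) : ContDiff ℝ (⊤ : ℕ∞) (smoothed τ ν P) := by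
  rw [contDiff_infty]
  intro n
  induction n generalizing P with
  | zero =>
    exact contDiff_zero.2 (continuous_iff_continuousAt.2
      fun x => (hasDerivAt_smoothed hτ ν P x).continuousAt)
  | succ n ih =>
    have : deriv (smoothed τ ν P) = smoothed τ ν (gaussDeriv τ P) :=
      funext fun x => (hasDerivAt_smoothed hτ ν P x).deriv
    push_cast
    refine contDiff_succ_iff_deriv.2 ⟨fun x => (hasDerivAt_smoothed hτ ν P x).differentiableAt,
      by simp, this ▸ ih _⟩

lemma exists_lipschitz_gaussMoment {τ : ℝ≥0} (hτ : 0 < τ) (P : Polynomial ℝ) :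
    ∃ L : ℝ, 0 ≤ L ∧ ∀ y z, |gaussMoment τ P y - gaussMoment τ P z| ≤ L * |y - z| := by
  obtain ⟨C, hC, h⟩ := exists_bound_gaussMoment hτ (gaussDeriv τ P)
  refine ⟨C, hC, fun y z => ?_⟩
  exact Convex.norm_image_sub_le_of_norm_hasDerivWithin_le (s := Set.univ)
    (fun x _ => (hasDerivAt_gaussMoment τ P x).hasDerivWithinAt) (fun x _ => h x) convex_univ
    (Set.mem_univ z) (Set.mem_univ y)

lemma smoothed_one_pos {τ : ℝ≥0} (hτ : 0 < τ) (ν : Measure ℝ) [IsProbabilityMeasure ν] (x : ℝ) :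
    0 < smoothed τ ν 1 x := by
  have hpos : ∀ u, 0 < gaussMoment τ 1 (x - u) := fun u => by
    simpa [gaussMoment] using gaussianPDFReal_pos 0 τ (x - u) hτ.ne'
  refine (integral_pos_iff_support_of_nonneg (fun u => (hpos u).le)
    (integrable_gaussMoment_sub hτ ν 1 x)).2 ?_
  have : Function.support (fun u => gaussMoment τ 1 (x - u)) = Set.univ := by
    ext u; simpa using (hpos u).ne'
  simp [this]

/-- The quotient `f' / f` where `f` is the convolution of `ν` with a Gaussian density. -/
def gaussScore (τ : ℝ≥0) (ν : Measure ℝ) (x : ℝ) : ℝ :=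
  smoothed τ ν (gaussDeriv τ 1) x / smoothed τ ν 1 x

lemma continuous_gaussScore {τ : ℝ≥0} (hτ : 0 < τ) (ν : Measure ℝ) [IsProbabilityMeasure ν] :
    Continuous (gaussScore τ ν) :=
  (contDiff_smoothed hτ ν _).continuous.div (contDiff_smoothed hτ ν _).continuous
    fun x => (smoothed_one_pos hτ ν x).ne'

/-! ### Joint law of a variable plus independent noise, and the variable itself. -/

section NoisyLaw

variable {G : Type*} [MeasurableSpace G] [AddCommGroup G] [MeasurableAdd₂ G] [MeasurableSub₂ G]
  {Ω : Type*} [MeasurableSpace Ω] {μ : Measure Ω} [IsProbabilityMeasure μ] {U Z : Ω → G}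
  {m : Measure G} [SFinite m] [m.IsAddLeftInvariant] {Φ : G → ℝ}

lemma map_add_prod_withDensity {Φ : G → ℝ≥0∞} (hΦ : Measurable Φ) (ν : Measure G) [SFinite ν] :
    (ν.prod (m.withDensity Φ)).map (fun p => (p.1 + p.2, p.1)) =
      (m.prod ν).withDensity fun q => Φ (q.1 - q.2) := by
  refine Measure.ext_of_lintegral _ fun H hH => ?_
  rw [lintegral_map hH (by fun_prop), lintegral_prod _ (by fun_prop),
    lintegral_withDensity_eq_lintegral_mul _ (by fun_prop) hH,
    lintegral_prod_symm' _ (by fun_prop)]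
  refine lintegral_congr fun u => ?_
  rw [lintegral_withDensity_eq_lintegral_mul _ hΦ (by fun_prop),
    ← lintegral_add_left_eq_self (fun x => ((fun q : G × G => Φ (q.1 - q.2)) * H) (x, u)) u]
  simp

/-- With this joint density, integrating over `u` at fixed `x` plays the role of conditioning on `U
+ Z = x`. The group is general because both `ℝ` and `ℝ × ℝ` are needed. -/
lemma hasLaw_add_noise (hΦ : Measurable Φ) (hU : AEMeasurable U μ)
    (hZ : HasLaw Z (m.withDensity fun x => ENNReal.ofReal (Φ x)) μ) (hI : IndepFun U Z μ) :
    HasLaw (fun ω => (U ω + Z ω, U ω))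
      ((m.prod (μ.map U)).withDensity fun q => ENNReal.ofReal (Φ (q.1 - q.2))) μ where
  aemeasurable := (hU.add hZ.aemeasurable).prodMk hU
  map_eq := by
    have h := (indepFun_iff_map_prod_eq_prod_map_map hU hZ.aemeasurable).1 hI
    rw [hZ.map_eq] at h
    rw [← map_add_prod_withDensity (Φ := fun x => ENNReal.ofReal (Φ x)) (by fun_prop), ← h,
      AEMeasurable.map_map_of_aemeasurable (by fun_prop) (hU.prodMk hZ.aemeasurable)]
    rfl

lemma integrable_add_noise_iff (hΦ : Measurable Φ) (hΦ0 : ∀ x, 0 ≤ Φ x) (hU : AEMeasurable U μ)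
    (hZ : HasLaw Z (m.withDensity fun x => ENNReal.ofReal (Φ x)) μ) (hI : IndepFun U Z μ)
    {H : G × G → ℝ} (hH : Measurable H) :
    Integrable (fun ω => H (U ω + Z ω, U ω)) μ ↔
      Integrable (fun q => Φ (q.1 - q.2) * H q) (m.prod (μ.map U)) := by
  have hl := hasLaw_add_noise hΦ hU hZ hI
  have h1 : Integrable H (μ.map fun ω => (U ω + Z ω, U ω)) ↔ _ :=
    integrable_map_measure hH.aestronglyMeasurable hl.aemeasurable
  rw [hl.map_eq, integrable_withDensity_iff (by fun_prop) (by simp)] at h1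
  refine h1.symm.trans (iff_of_eq (congrArg (fun g => Integrable g _) (funext fun q => ?_)))
  rw [ENNReal.toReal_ofReal (hΦ0 _), mul_comm]

lemma integral_add_noise (hΦ : Measurable Φ) (hΦ0 : ∀ x, 0 ≤ Φ x) (hU : AEMeasurable U μ)
    (hZ : HasLaw Z (m.withDensity fun x => ENNReal.ofReal (Φ x)) μ) (hI : IndepFun U Z μ)
    {H : G × G → ℝ} (hH : Measurable H) (hint : Integrable (fun ω => H (U ω + Z ω, U ω)) μ) :
    ∫ ω, H (U ω + Z ω, U ω) ∂μ = ∫ x, ∫ u, Φ (x - u) * H (x, u) ∂(μ.map U) ∂m := by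
  have hl := hasLaw_add_noise hΦ hU hZ hI
  have h1 := hl.integral_comp (f := H) hH.aestronglyMeasurable
  rw [integral_withDensity_eq_integral_toReal_smul (by fun_prop) (by simp)] at h1
  refine h1.trans ?_
  rw [← integral_prod _ ((integrable_add_noise_iff hΦ hΦ0 hU hZ hI hH).1 hint)]
  refine integral_congr_ae (.of_forall fun q => ?_)
  simp only [ENNReal.toReal_ofReal (hΦ0 _), smul_eq_mul]

end NoisyLaw

/-! ### Scores of Gaussian-smoothed variables: orthogonality, moments, linear growth. -/

lemma IsSmoothDensity.density_eq {Ω : Type*} [MeasurableSpace Ω] {μ : Measure Ω}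
    [IsProbabilityMeasure μ] {f : ℝ → ℝ} {U : Ω → ℝ} (h : IsSmoothDensity f U μ) :
    density U μ = f := by
  have hex : ∃ f, IsSmoothDensity f U μ := ⟨f, h⟩
  rw [density, dif_pos hex]
  have h' := hex.choose_spec
  set g := hex.choose
  have hg : Continuous g := h'.smooth.continuous
  have hf : Continuous f := h.smooth.continuous
  have h1 := h'.hasLaw.map_eq.symm.trans h.hasLaw.map_eq
  rw [withDensity_eq_iff_of_sigmaFinite (by fun_prop) (by fun_prop)] at h1
  refine (Continuous.ae_eq_iff_eq volume hg hf).1 (h1.mono fun x hx => ?_)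
  have hx' : ENNReal.ofReal (g x) = ENNReal.ofReal (f x) := hx
  rwa [ENNReal.ofReal_eq_ofReal_iff (h'.nonneg x) (h.nonneg x)] at hx'

lemma pow_tangent_le {n : ℕ} (hn : Even n) (r u : ℝ) : r ^ n + n * r ^ (n - 1) * (u - r) ≤ u ^ n := by
  have hc := hn.convexOn_pow (𝕜 := ℝ)
  have hd : HasDerivAt (fun x : ℝ => x ^ n) (n * r ^ (n - 1)) r := hasDerivAt_pow n r
  rcases lt_trichotomy u r with hlt | rfl | hlt
  · have := hc.slope_le_of_hasDerivAt (Set.mem_univ u) (Set.mem_univ r) hlt hd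
    rw [slope_def_field, div_le_iff₀ (by linarith)] at this
    linarith
  · simp
  · have := hc.le_slope_of_hasDerivAt (Set.mem_univ r) (Set.mem_univ u) hlt hd
    rw [slope_def_field, le_div_iff₀ (by linarith)] at this
    linarith

/-- `U` is centred with second moment at most `V`, and `Z` is an independent Gaussian variable of
law `N(0, τ)`. -/
structure IsNoisy {Ω : Type*} [MeasurableSpace Ω] (U Z : Ω → ℝ) (V : ℝ) (τ : ℝ≥0)
    (μ : Measure Ω) : Prop where
  pos : 0 < τ
  memLp : MemLp U 2 μ
  mean : ∫ ω, U ω ∂μ = 0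
  sq_le : ∫ ω, U ω ^ 2 ∂μ ≤ V
  law : HasLaw Z (gaussianReal 0 τ) μ
  indep : IndepFun U Z μ

namespace IsNoisy

variable {Ω : Type*} [MeasurableSpace Ω] {μ : Measure Ω} {U Z : Ω → ℝ}
  {V : ℝ} {τ : ℝ≥0}

lemma aemeasurable (h : IsNoisy U Z V τ μ) : AEMeasurable U μ := h.memLp.1.aemeasurable

lemma law' (h : IsNoisy U Z V τ μ) :
    HasLaw Z (volume.withDensity fun x => ENNReal.ofReal (gaussianPDFReal 0 τ x)) μ := by
  have := h.law
  rwa [gaussianReal_of_var_ne_zero _ h.pos.ne'] at this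

lemma integrable_pow_noise (h : IsNoisy U Z V τ μ) (n : ℕ) : Integrable (fun ω => Z ω ^ n) μ := by
  have h1 : Integrable (fun x : ℝ => x ^ n) (gaussianReal 0 τ) := by
    rcases eq_or_ne n 0 with rfl | hn
    · simp
    have h2 := (memLp_id_gaussianReal (μ := 0) (v := τ) n).integrable_norm_pow hn
    refine (integrable_norm_iff (by fun_prop)).1 ?_
    simpa using h2
  rw [← h.law.map_eq] at h1
  exact h1.comp_aemeasurable h.law.aemeasurable

variable [IsProbabilityMeasure μ]

lemma isProbabilityMeasure_map (h : IsNoisy U Z V τ μ) : IsProbabilityMeasure (μ.map U) :=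
  Measure.isProbabilityMeasure_map h.aemeasurable

lemma integrable_iff (h : IsNoisy U Z V τ μ) {H : ℝ × ℝ → ℝ} (hH : Measurable H) :
    Integrable (fun ω => H (U ω + Z ω, U ω)) μ ↔
      Integrable (fun q => gaussianPDFReal 0 τ (q.1 - q.2) * H q) (volume.prod (μ.map U)) :=
  integrable_add_noise_iff (measurable_gaussianPDFReal _ _) (gaussianPDFReal_nonneg _ _)
    h.aemeasurable h.law' h.indep hH

lemma integral_eq (h : IsNoisy U Z V τ μ) {H : ℝ × ℝ → ℝ} (hH : Measurable H)
    (hint : Integrable (fun ω => H (U ω + Z ω, U ω)) μ) :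
    ∫ ω, H (U ω + Z ω, U ω) ∂μ =
      ∫ x, ∫ u, gaussianPDFReal 0 τ (x - u) * H (x, u) ∂(μ.map U) :=
  integral_add_noise (measurable_gaussianPDFReal _ _) (gaussianPDFReal_nonneg _ _)
    h.aemeasurable h.law' h.indep hH hint

lemma isSmoothDensity (h : IsNoisy U Z V τ μ) :
    IsSmoothDensity (smoothed τ (μ.map U) 1) (U + Z) μ where
  smooth := have := h.isProbabilityMeasure_map; contDiff_smoothed h.pos _ _
  nonneg x := have := h.isProbabilityMeasure_map; (smoothed_one_pos h.pos _ x).le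
  hasLaw := by
    have := h.isProbabilityMeasure_map
    have hl := hasLaw_add_noise (measurable_gaussianPDFReal 0 τ) h.aemeasurable h.law' h.indep
    refine ⟨h.aemeasurable.add h.law.aemeasurable, ?_⟩
    have h1 : μ.map (U + Z) = (μ.map fun ω => (U ω + Z ω, U ω)).map Prod.fst := by
      rw [AEMeasurable.map_map_of_aemeasurable (by fun_prop) hl.aemeasurable]; rfl
    rw [h1, hl.map_eq]
    have hm := measurable_gaussianPDFReal 0 τ
    refine Measure.ext_of_lintegral _ fun H hH => ?_
    rw [lintegral_map hH measurable_fst, lintegral_withDensity_eq_lintegral_mul _ (by fun_prop)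
      (by fun_prop), lintegral_prod _ (by fun_prop), lintegral_withDensity_eq_lintegral_mul _ ?_ hH]
    · refine lintegral_congr fun x => ?_
      simp only [Pi.mul_apply]
      rw [lintegral_mul_const _ (by fun_prop), smoothed, ofReal_integral_eq_lintegral_ofReal
        (integrable_gaussMoment_sub h.pos _ 1 x)
        (.of_forall fun u => by simpa [gaussMoment] using gaussianPDFReal_nonneg 0 τ (x - u))]
      simp [gaussMoment]
    · exact (contDiff_smoothed h.pos (μ.map U) 1).continuous.measurable.ennreal_ofReal

lemma score_eq (h : IsNoisy U Z V τ μ) : score (U + Z) μ = gaussScore τ (μ.map U) := by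
  have := h.isProbabilityMeasure_map
  funext x
  rw [score, h.isSmoothDensity.density_eq, (hasDerivAt_smoothed h.pos _ _ _).deriv, gaussScore]

lemma measurable_score (h : IsNoisy U Z V τ μ) : Measurable (score (U + Z) μ) := by
  have := h.isProbabilityMeasure_map
  exact h.score_eq ▸ (continuous_gaussScore h.pos _).measurable

/-- The score is the conditional expectation of `-Z / τ`, in integrated form. -/
lemma integral_score_add (h : IsNoisy U Z V τ μ) (x : ℝ) :
    ∫ u, gaussianPDFReal 0 τ (x - u) * (score (U + Z) μ x + (x - u) / τ) ∂(μ.map U) = 0 := by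
  have := h.isProbabilityMeasure_map
  have h1 : ∀ u, gaussianPDFReal 0 τ (x - u) * (score (U + Z) μ x + (x - u) / τ) =
      score (U + Z) μ x * gaussMoment τ 1 (x - u) - gaussMoment τ (gaussDeriv τ 1) (x - u) := by
    intro u
    simp [gaussMoment, gaussDeriv]
    ring
  simp_rw [h1]
  rw [integral_sub ((integrable_gaussMoment_sub h.pos _ _ _).const_mul _)
    (integrable_gaussMoment_sub h.pos _ _ _), integral_const_mul, h.score_eq]
  have := (smoothed_one_pos h.pos (μ.map U) x).ne'
  change gaussScore τ (μ.map U) x * smoothed τ (μ.map U) 1 x - smoothed τ (μ.map U) _ x = 0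
  rw [gaussScore]
  field_simp
  ring

/-- The orthogonality of `ρ(U + Z) + Z / τ` to functions of `U + Z`. Taking `k` to be the score
itself, for the mixture, gives one of the two identities behind `scoreGap_eq`. -/
lemma integral_mul_score_add (h : IsNoisy U Z V τ μ) {k : ℝ → ℝ} (hk : Measurable k)
    (hint : Integrable (fun ω => k (U ω + Z ω) * (score (U + Z) μ (U ω + Z ω) + Z ω / τ)) μ) :
    ∫ ω, k (U ω + Z ω) * (score (U + Z) μ (U ω + Z ω) + Z ω / τ) ∂μ = 0 := by
  have hs := h.measurable_score
  have := h.integral_eq (H := fun q => k q.1 * (score (U + Z) μ q.1 + (q.1 - q.2) / τ))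
    (by fun_prop) (by simpa using hint)
  simp only [add_sub_cancel_left] at this
  rw [this]
  refine integral_eq_zero_of_ae (.of_forall fun x => ?_)
  simp_rw [mul_left_comm _ (k x), integral_const_mul, h.integral_score_add, mul_zero]
  rfl

lemma integrable_gauss_mul_pow (h : IsNoisy U Z V τ μ) (n : ℕ) (x : ℝ) :
    Integrable (fun u => gaussianPDFReal 0 τ (x - u) * ((x - u) / τ) ^ n) (μ.map U) := by
  have := h.isProbabilityMeasure_map
  convert (integrable_gaussMoment_sub h.pos (μ.map U)
    (Polynomial.C ((τ : ℝ)⁻¹ ^ n) * Polynomial.X ^ n) x) using 2 with u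
  simp [gaussMoment, div_pow]
  ring

/-- Conditional Jensen for the even power: its tangent line at the score is integrated against `φ(x
- u)`, and the linear term vanishes by `integral_score_add`. -/
lemma score_pow_mul_le (h : IsNoisy U Z V τ μ) {n : ℕ} (hn : Even n) (x : ℝ) :
    score (U + Z) μ x ^ n * smoothed τ (μ.map U) 1 x ≤
      ∫ u, gaussianPDFReal 0 τ (x - u) * ((x - u) / τ) ^ n ∂(μ.map U) := by
  have := h.isProbabilityMeasure_map
  set r := score (U + Z) μ x with hr
  have i0 : Integrable (fun u => gaussianPDFReal 0 τ (x - u)) (μ.map U) := by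
    simpa using h.integrable_gauss_mul_pow 0 x
  have i1 : Integrable (fun u => gaussianPDFReal 0 τ (x - u) * (r + (x - u) / τ)) (μ.map U) := by
    simp_rw [mul_add]
    exact (i0.mul_const r).add (by simpa using h.integrable_gauss_mul_pow 1 x)
  have e : ∫ u, (r ^ n * gaussianPDFReal 0 τ (x - u)
      + (-(n * r ^ (n - 1))) * (gaussianPDFReal 0 τ (x - u) * (r + (x - u) / τ))) ∂(μ.map U)
      = r ^ n * smoothed τ (μ.map U) 1 x := by
    rw [integral_add (i0.const_mul _) (i1.const_mul _), integral_const_mul, integral_const_mul,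
      hr, h.integral_score_add]
    simp [smoothed, gaussMoment]
  rw [← e]
  refine integral_mono ((i0.const_mul _).add (i1.const_mul _)) (h.integrable_gauss_mul_pow n x)
    fun u => ?_
  have h1 := pow_tangent_le hn r (-((x - u) / τ))
  rw [hn.neg_pow] at h1
  have h2 := mul_le_mul_of_nonneg_left h1 (gaussianPDFReal_nonneg 0 τ (x - u))
  refine le_of_eq_of_le ?_ h2
  ring

/-- The pointwise Jensen inequality integrated in `x`. The resulting bound depends on `τ` and `n`
alone, hence is uniform over all laws of `U`. -/
lemma integrable_score_pow (h : IsNoisy U Z V τ μ) {n : ℕ} (hn : Even n) :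
    Integrable (fun ω => score (U + Z) μ (U ω + Z ω) ^ n) μ ∧
      ∫ ω, score (U + Z) μ (U ω + Z ω) ^ n ∂μ ≤ ∫ ω, (Z ω / τ) ^ n ∂μ := by
  have := h.isProbabilityMeasure_map
  have hs := h.measurable_score
  have iZ : Integrable (fun ω => (Z ω / τ) ^ n) μ := by
    simp_rw [div_pow]; exact (h.integrable_pow_noise n).div_const _
  have hm : Measurable fun q : ℝ × ℝ => ((q.1 - q.2) / (τ : ℝ)) ^ n := by fun_prop
  have hm' : Measurable fun q : ℝ × ℝ => score (U + Z) μ q.1 ^ n := by fun_prop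
  have iZ' : Integrable (fun ω => ((U ω + Z ω - U ω) / τ) ^ n) μ := by simpa using iZ
  have i2 := (h.integrable_iff hm).1 iZ'
  have e2 := h.integral_eq hm iZ'
  have i3 : Integrable (fun x => score (U + Z) μ x ^ n * smoothed τ (μ.map U) 1 x) := by
    refine i2.integral_prod_left.mono' ?_ (.of_forall fun x => ?_)
    · have := (contDiff_smoothed h.pos (μ.map U) 1).continuous
      have hm3 : Measurable fun x => score (U + Z) μ x ^ n * smoothed τ (μ.map U) 1 x := by fun_prop
      exact hm3.aestronglyMeasurable
    · rw [Real.norm_of_nonneg (mul_nonneg (hn.pow_nonneg _) (smoothed_one_pos h.pos _ x).le)]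
      exact h.score_pow_mul_le hn x
  have key : ∀ x, ∫ u, gaussianPDFReal 0 τ (x - u) * score (U + Z) μ x ^ n ∂(μ.map U) =
      score (U + Z) μ x ^ n * smoothed τ (μ.map U) 1 x := fun x => by
    rw [integral_mul_const, mul_comm]
    simp [smoothed, gaussMoment]
  have i4 : Integrable (fun ω => score (U + Z) μ (U ω + Z ω) ^ n) μ := by
    refine (h.integrable_iff hm').2 ?_
    have hg := measurable_gaussianPDFReal 0 τ
    refine (integrable_prod_iff (by fun_prop)).2 ⟨.of_forall fun x => ?_, ?_⟩
    · have i0 : Integrable (fun u => gaussianPDFReal 0 τ (x - u)) (μ.map U) := by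
        simpa using h.integrable_gauss_mul_pow 0 x
      exact i0.mul_const (score (U + Z) μ x ^ n)
    · refine i3.congr (.of_forall fun x => ?_)
      simp only [← key]
      refine integral_congr_ae (.of_forall fun u => ?_)
      simp only
      rw [Real.norm_of_nonneg (mul_nonneg (gaussianPDFReal_nonneg _ _ _) (hn.pow_nonneg _))]
  refine ⟨i4, ?_⟩
  rw [h.integral_eq hm' i4]
  simp only [add_sub_cancel_left] at e2
  rw [e2]
  simp only [key]
  exact integral_mono i3 i2.integral_prod_left (h.score_pow_mul_le hn)

/-- A Chebyshev association argument: `φ(x - u)` decreases as `(x - u)²` increases, so the Gaussian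
weight can only lower the mean of `(x - u)²`, which unweighted is at most `x² + V`. Concretely, `((x
- u)² - c) (φ(x - u) - φ(√c)) ≤ 0` with `c = x² + V`. -/
lemma integral_gauss_mul_sq_le (h : IsNoisy U Z V τ μ) (x : ℝ) :
    ∫ u, gaussianPDFReal 0 τ (x - u) * ((x - u) / τ) ^ 2 ∂(μ.map U) ≤
      (x ^ 2 + V) / τ ^ 2 * smoothed τ (μ.map U) 1 x := by
  have := h.isProbabilityMeasure_map
  have hτ : (0 : ℝ) < τ := h.pos
  have hV : 0 ≤ V := (integral_nonneg fun ω => sq_nonneg _).trans h.sq_le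
  set c := x ^ 2 + V with hc
  have hc0 : 0 ≤ c := by positivity
  have mU : MemLp (fun u : ℝ => u) 2 (μ.map U) := by
    refine (memLp_map_measure_iff (by fun_prop) h.aemeasurable).2 h.memLp
  have iU : Integrable (fun u : ℝ => u) (μ.map U) := mU.integrable (by norm_num)
  have iU2 : Integrable (fun u : ℝ => u ^ 2) (μ.map U) := mU.integrable_sq
  have eU : ∫ u, u ∂(μ.map U) = 0 := by
    rw [integral_map h.aemeasurable (by fun_prop)]; exact h.mean
  have eU2 : ∫ u, u ^ 2 ∂(μ.map U) ≤ V := by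
    rw [integral_map h.aemeasurable (by fun_prop)]; exact h.sq_le
  have i0 : Integrable (fun u => gaussianPDFReal 0 τ (x - u)) (μ.map U) := by
    simpa using h.integrable_gauss_mul_pow 0 x
  have i2 := h.integrable_gauss_mul_pow 2 x
  set d := gaussianPDFReal 0 τ (√c) with hd
  have hd0 : 0 ≤ d := gaussianPDFReal_nonneg _ _ _
  have pt : ∀ u, gaussianPDFReal 0 τ (x - u) * ((x - u) / τ) ^ 2 ≤
      c / τ ^ 2 * gaussianPDFReal 0 τ (x - u) + d / τ ^ 2 * (-(2 * x) * u + (u ^ 2 - V)) := by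
    intro u
    have hsq : √c ^ 2 = c := Real.sq_sqrt hc0
    have h0 : ((x - u) ^ 2 - c) * (gaussianPDFReal 0 τ (x - u) - d) ≤ 0 := by
      rcases le_total c ((x - u) ^ 2) with hle | hle
      · refine mul_nonpos_of_nonneg_of_nonpos (by linarith) (sub_nonpos.2 ?_)
        simp only [hd, gaussianPDFReal, sub_zero, hsq]
        gcongr
      · refine mul_nonpos_of_nonpos_of_nonneg (by linarith) (sub_nonneg.2 ?_)
        simp only [hd, gaussianPDFReal, sub_zero, hsq]
        gcongr
    have h1 := div_nonpos_of_nonpos_of_nonneg h0 (sq_nonneg (τ : ℝ))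
    have h2 : gaussianPDFReal 0 τ (x - u) * ((x - u) / τ) ^ 2 -
      (c / τ ^ 2 * gaussianPDFReal 0 τ (x - u) + d / τ ^ 2 * (-(2 * x) * u + (u ^ 2 - V))) =
      ((x - u) ^ 2 - c) * (gaussianPDFReal 0 τ (x - u) - d) / τ ^ 2 := by
      rw [hc]
      field_simp
      ring
    linarith
  have i4 : Integrable (fun u : ℝ => u ^ 2 - V) (μ.map U) := iU2.sub (integrable_const V)
  have i3 : Integrable (fun u => -(2 * x) * u + (u ^ 2 - V)) (μ.map U) :=
    (iU.const_mul (-(2 * x))).add i4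
  refine (integral_mono i2 ((i0.const_mul _).add (i3.const_mul _)) pt).trans ?_
  simp only [Pi.add_apply]
  rw [integral_add (i0.const_mul _) (i3.const_mul _), integral_const_mul, integral_const_mul,
    integral_add (iU.const_mul (-(2 * x))) i4,
    integral_sub iU2 (integrable_const V), integral_const_mul, eU]
  have : smoothed τ (μ.map U) 1 x = ∫ u, gaussianPDFReal 0 τ (x - u) ∂(μ.map U) := by
    simp [smoothed, gaussMoment]
  rw [this]
  have h5 : d / τ ^ 2 * (∫ u, u ^ 2 ∂(μ.map U) - V) ≤ 0 :=
    mul_nonpos_of_nonneg_of_nonpos (by positivity) (by linarith)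
  simp at h5 ⊢
  linarith

/-- Jensen with exponent 2 and the previous estimate give `ρ(x)² ≤ (x² + V) / τ²`. This linear
growth determines the powers of `B` in the truncation argument. -/
lemma abs_score_le (h : IsNoisy U Z V τ μ) (x : ℝ) : |score (U + Z) μ x| ≤ (|x| + √V) / τ := by
  have := h.isProbabilityMeasure_map
  have hτ : (0 : ℝ) < τ := h.pos
  have hV : 0 ≤ V := (integral_nonneg fun ω => sq_nonneg _).trans h.sq_le
  have h1 := (h.score_pow_mul_le even_two x).trans (h.integral_gauss_mul_sq_le x)
  have h2 := le_of_mul_le_mul_right h1 (smoothed_one_pos h.pos _ x)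
  refine abs_le_of_sq_le_sq (h2.trans ?_) (by positivity)
  rw [div_pow]
  gcongr
  nlinarith [Real.sq_sqrt hV, sq_abs x, mul_nonneg (abs_nonneg x) (Real.sqrt_nonneg V)]

lemma hasFiniteFisherInfo (h : IsNoisy U Z V τ μ) : HasFiniteFisherInfo (U + Z) μ := by
  refine ⟨⟨_, h.isSmoothDensity⟩, ?_⟩
  refine (memLp_two_iff_integrable_sq ?_).2 (h.integrable_score_pow even_two).1
  exact (h.measurable_score.comp_aemeasurable
    (h.aemeasurable.add h.law.aemeasurable)).aestronglyMeasurable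

end IsNoisy

/-! ### Newman's covariance inequality. -/

section Newman

variable {Ω : Type*} [MeasurableSpace Ω] {μ : Measure Ω} {S T : Ω → ℝ}

lemma monotone_mul_add_of_lipschitz {f : ℝ → ℝ} {A : ℝ} (hf : ∀ y z, |f y - f z| ≤ A * |y - z|) :
    Monotone fun y => A * y + f y := by
  intro y z hyz
  have := (abs_le.1 (hf y z)).2
  rw [abs_sub_comm, abs_of_nonneg (sub_nonneg.2 hyz)] at this
  simp only
  linarith

/-- The covariance of increasing functions of each of two FKG variables is non-negative. -/
lemma IsFKG.covariance_nonneg (h : IsFKG ![S, T] μ) {f g : ℝ → ℝ} (hf : Monotone f)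
    (hg : Monotone g) (hfS : MemLp (fun ω => f (S ω)) 2 μ) (hgT : MemLp (fun ω => g (T ω)) 2 μ) :
    0 ≤ cov[fun ω => f (S ω), fun ω => g (T ω); μ] :=
  h (fun v => f (v 0)) (fun v => g (v 1)) (fun _ _ h => hf (h 0)) (fun _ _ h => hg (h 1))
    (hf.measurable.comp (measurable_pi_apply 0)) (hg.measurable.comp (measurable_pi_apply 1)) hfS hgT

/-- Newman's covariance inequality for Lipschitz functions of two FKG variables. -/
lemma IsFKG.abs_covariance_le [IsFiniteMeasure μ] (h : IsFKG ![S, T] μ) (hS : MemLp S 2 μ) (hT : MemLp T 2 μ)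
    {f g : ℝ → ℝ} {A B : ℝ} (hf : ∀ y z, |f y - f z| ≤ A * |y - z|)
    (hg : ∀ y z, |g y - g z| ≤ B * |y - z|)
    (hfS : MemLp (fun ω => f (S ω)) 2 μ) (hgT : MemLp (fun ω => g (T ω)) 2 μ) :
    |cov[fun ω => f (S ω), fun ω => g (T ω); μ]| ≤ A * B * cov[S, T; μ] := by
  have hf' : ∀ y z, |-f y - -f z| ≤ A * |y - z| := fun y z => by
    rw [← neg_sub_neg, neg_neg, neg_neg, abs_sub_comm]; simpa [abs_sub_comm] using hf y z
  have hg' : ∀ y z, |-g y - -g z| ≤ B * |y - z| := fun y z => by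
    rw [← neg_sub_neg, neg_neg, neg_neg, abs_sub_comm]; simpa [abs_sub_comm] using hg y z
  -- The FKG property applied to the increasing functions `A s + f s` and `B t + g t`, with the
  -- covariance expanded bilinearly.
  have key : ∀ {f g : ℝ → ℝ}, (∀ y z, |f y - f z| ≤ A * |y - z|) →
      (∀ y z, |g y - g z| ≤ B * |y - z|) → MemLp (fun ω => f (S ω)) 2 μ →
      MemLp (fun ω => g (T ω)) 2 μ →
      0 ≤ A * B * cov[S, T; μ] + A * cov[S, fun ω => g (T ω); μ] +
        (B * cov[fun ω => f (S ω), T; μ] + cov[fun ω => f (S ω), fun ω => g (T ω); μ]) := by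
    intro f g hf hg hfS hgT
    have hAS : MemLp (fun ω => A * S ω) 2 μ := hS.const_mul A
    have hBT : MemLp (fun ω => B * T ω) 2 μ := hT.const_mul B
    have h1 := h.covariance_nonneg (monotone_mul_add_of_lipschitz hf)
      (monotone_mul_add_of_lipschitz hg) (hAS.add hfS) (hBT.add hgT)
    have h2 := covariance_add_left hAS hfS (hBT.add hgT)
    rw [covariance_add_right hAS hBT hgT, covariance_add_right hfS hBT hgT,
      covariance_const_mul_left, covariance_const_mul_right, covariance_const_mul_left,
      covariance_const_mul_right] at h2
    have h3 := h1.trans_eq h2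
    linarith
  -- Over the four sign choices of `f` and `g`, the mixed covariances cancel in `k1 + k2` and in `k3
  -- + k4`, leaving the lower and the upper bound.
  have k1 := key hf hg hfS hgT
  have k2 := key hf' hg' hfS.neg hgT.neg
  have k3 := key hf hg' hfS hgT.neg
  have k4 := key hf' hg hfS.neg hgT
  simp only [covariance_fun_neg_left, covariance_fun_neg_right] at k1 k2 k3 k4
  rw [abs_le]
  constructor <;> linarith

end Newman

/-! ### Noisy FKG pairs: correlations inside a box. -/

lemma prod_gaussianReal {τ : ℝ≥0} (hτ : 0 < τ) :
    (gaussianReal 0 τ).prod (gaussianReal 0 τ) = (volume : Measure (ℝ × ℝ)).withDensity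
      fun p => ENNReal.ofReal (gaussianPDFReal 0 τ p.1 * gaussianPDFReal 0 τ p.2) := by
  rw [gaussianReal_of_var_ne_zero _ hτ.ne', prod_withDensity (measurable_gaussianPDF _ _)
    (measurable_gaussianPDF _ _), ← Measure.volume_eq_prod]
  congr 1
  funext p
  rw [ENNReal.ofReal_mul (gaussianPDFReal_nonneg _ _ _), gaussianPDF, gaussianPDF]

namespace IsFKGPairWithNoise

variable {Ω : Type*} [MeasurableSpace Ω] {μ : Measure Ω}
  {S T ZS ZT : Ω → ℝ} {K : ℝ} {τ : ℝ≥0}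

/-- Swapping coordinates is monotone. The second correlation in `scoreGap_eq` is thereby an instance
of the estimate for the first. -/
lemma symm (h : IsFKGPairWithNoise S T ZS ZT K τ μ) : IsFKGPairWithNoise T S ZT ZS K τ μ where
  fkg F G hF hG hFm hGm hF2 hG2 := by
    have hm : Monotone fun v : Fin 2 → ℝ => ![v 1, v 0] := by
      intro v w hvw i
      fin_cases i
      · exact hvw 1
      · exact hvw 0
    have hmm : Measurable fun v : Fin 2 → ℝ => ![v 1, v 0] := by
      refine measurable_pi_lambda _ fun i => ?_
      fin_cases i
      · exact measurable_pi_apply 1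
      · exact measurable_pi_apply 0
    have e : ∀ ω, (fun i => ![T, S] i ω) = ![(fun i => ![S, T] i ω) 1, (fun i => ![S, T] i ω) 0] := by
      intro ω
      funext i
      fin_cases i <;> rfl
    simp only [e] at hF2 hG2 ⊢
    exact h.fkg (fun v => F ![v 1, v 0]) (fun v => G ![v 1, v 0]) (hF.comp hm) (hG.comp hm)
      (hFm.comp hmm) (hGm.comp hmm) hF2 hG2
  memLp_S := h.memLp_T
  memLp_T := h.memLp_S
  mean_S := h.mean_T
  mean_T := h.mean_S
  var_S := h.var_T
  var_T := h.var_S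
  law_ZS := h.law_ZT
  law_ZT := h.law_ZS
  indep_noise := h.indep_noise.symm
  indep := h.indep.comp measurable_swap measurable_swap

lemma integral_sq_le (h : IsFKGPairWithNoise S T ZS ZT K τ μ) : ∫ ω, S ω ^ 2 ∂μ ≤ K := by
  have := h.var_S
  rwa [variance_of_integral_eq_zero h.memLp_S.1.aemeasurable h.mean_S] at this

lemma isNoisy_left (h : IsFKGPairWithNoise S T ZS ZT K τ μ) (hτ : 0 < τ) : IsNoisy S ZS K τ μ where
  pos := hτ
  memLp := h.memLp_S
  mean := h.mean_S
  sq_le := h.integral_sq_le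
  law := h.law_ZS
  indep := h.indep.comp measurable_fst measurable_fst

lemma covariance_nonneg (h : IsFKGPairWithNoise S T ZS ZT K τ μ) : 0 ≤ cov[S, T; μ] :=
  h.fkg.covariance_nonneg monotone_id monotone_id h.memLp_S h.memLp_T

variable [IsProbabilityMeasure μ]

/-- The normalization `a² + b² = 1` keeps the noise variance at `τ`. By Cauchy–Schwarz, `(a S + b
T)² ≤ S² + T²`, whence the bound `2 * K`, uniform in `a` and `b`. -/
lemma isNoisy_mix (h : IsFKGPairWithNoise S T ZS ZT K τ μ) (hτ : 0 < τ) {a b : ℝ}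
    (hab : a ^ 2 + b ^ 2 = 1) :
    IsNoisy (fun ω => a * S ω + b * T ω) (fun ω => a * ZS ω + b * ZT ω) (2 * K) τ μ where
  pos := hτ
  memLp := (h.memLp_S.const_mul a).add (h.memLp_T.const_mul b)
  mean := by
    rw [integral_add ((h.memLp_S.integrable (by norm_num)).const_mul a)
      ((h.memLp_T.integrable (by norm_num)).const_mul b), integral_const_mul, integral_const_mul,
      h.mean_S, h.mean_T]
    simp
  sq_le := by
    have i1 := h.memLp_S.integrable_sq
    have i2 := h.memLp_T.integrable_sq
    have := h.integral_sq_le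
    have := h.symm.integral_sq_le
    calc ∫ ω, (a * S ω + b * T ω) ^ 2 ∂μ ≤ ∫ ω, (S ω ^ 2 + T ω ^ 2) ∂μ := by
          refine integral_mono ((h.memLp_S.const_mul a).add (h.memLp_T.const_mul b)).integrable_sq
            (i1.add i2) fun ω => ?_
          have e : S ω ^ 2 + T ω ^ 2 = (a ^ 2 + b ^ 2) * (S ω ^ 2 + T ω ^ 2) := by rw [hab, one_mul]
          simp only
          nlinarith [sq_nonneg (a * T ω - b * S ω)]
      _ = ∫ ω, S ω ^ 2 ∂μ + ∫ ω, T ω ^ 2 ∂μ := integral_add i1 i2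
      _ ≤ 2 * K := by linarith
  law := by
    have h1 := gaussianReal_const_mul h.law_ZS a
    have h2 := gaussianReal_const_mul h.law_ZT b
    have h3 := gaussianReal_add_gaussianReal_of_indepFun
      (h.indep_noise.comp (measurable_const_mul a) (measurable_const_mul b)) h1.map_eq h2.map_eq
    refine ⟨h1.aemeasurable.add h2.aemeasurable, ?_⟩
    refine Eq.trans h3 ?_
    congr 1
    · simp
    · refine NNReal.coe_injective ?_
      push_cast
      rw [← add_mul]
      exact (congrArg (· * (τ : ℝ)) hab).trans (one_mul _)
  indep := h.indep.comp (φ := fun p : ℝ × ℝ => a * p.1 + b * p.2)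
    (ψ := fun p : ℝ × ℝ => a * p.1 + b * p.2) (by fun_prop) (by fun_prop)

lemma law_noise (h : IsFKGPairWithNoise S T ZS ZT K τ μ) (hτ : 0 < τ) :
    HasLaw (fun ω => (ZS ω, ZT ω)) ((volume : Measure (ℝ × ℝ)).withDensity
      fun p => ENNReal.ofReal (gaussianPDFReal 0 τ p.1 * gaussianPDFReal 0 τ p.2)) μ := by
  refine ⟨h.law_ZS.aemeasurable.prodMk h.law_ZT.aemeasurable, ?_⟩
  rw [(indepFun_iff_map_prod_eq_prod_map_map h.law_ZS.aemeasurable h.law_ZT.aemeasurable).1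
    h.indep_noise, h.law_ZS.map_eq, h.law_ZT.map_eq, prod_gaussianReal hτ]

lemma covariance_le (h : IsFKGPairWithNoise S T ZS ZT K τ μ) : cov[S, T; μ] ≤ K := by
  have h1 := h.integral_sq_le
  have h2 := h.symm.integral_sq_le
  rw [covariance_eq_sub h.memLp_S h.memLp_T, h.mean_S, h.mean_T, mul_zero, sub_zero]
  have i1 := h.memLp_S.integrable_sq
  have i2 := h.memLp_T.integrable_sq
  calc μ[S * T] ≤ ∫ ω, (S ω ^ 2 / 2 + T ω ^ 2 / 2) ∂μ := by
        refine integral_mono (h.memLp_S.integrable_mul h.memLp_T)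
          ((i1.div_const 2).add (i2.div_const 2)) fun ω => ?_
        simp only [Pi.mul_apply]
        nlinarith [sq_nonneg (S ω - T ω)]
    _ = (∫ ω, S ω ^ 2 ∂μ) / 2 + (∫ ω, T ω ^ 2 ∂μ) / 2 := by
        rw [integral_add (i1.div_const 2) (i2.div_const 2), integral_div, integral_div]
    _ ≤ K := by linarith

/-- The integrand is `g(s) φ(y - t)` with `g` of mean zero under the law of `S` by
`integral_score_add`, so the integral is a covariance and Newman's inequality applies. The Lipschitz
constant of `g` grows with `|ρ_X(x)|`. -/
lemma abs_integral_gauss_mul_gauss_le (h : IsFKGPairWithNoise S T ZS ZT K τ μ) (hτ : 0 < τ) {L : ℝ}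
    (hL : ∀ y z, |gaussMoment τ 1 y - gaussMoment τ 1 z| ≤ L * |y - z|)
    (hL' : ∀ y z, |gaussMoment τ (gaussDeriv τ 1) y - gaussMoment τ (gaussDeriv τ 1) z| ≤
      L * |y - z|) (x y : ℝ) :
    |∫ q : ℝ × ℝ, gaussianPDFReal 0 τ (x - q.1) * gaussianPDFReal 0 τ (y - q.2) *
        (score (S + ZS) μ x + (x - q.1) / τ) ∂(μ.map fun ω => (S ω, T ω))| ≤
      L * (1 + |score (S + ZS) μ x|) * L * cov[S, T; μ] := by
  have hS := h.memLp_S.1.aemeasurable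
  have hT := h.memLp_T.1.aemeasurable
  set r := score (S + ZS) μ x with hr
  set g : ℝ → ℝ := fun s => r * gaussMoment τ 1 (x - s) - gaussMoment τ (gaussDeriv τ 1) (x - s)
    with hg
  have hg' : ∀ s, g s = gaussianPDFReal 0 τ (x - s) * (r + (x - s) / τ) := fun s => by
    simp [hg, gaussMoment, gaussDeriv]; ring
  have c1 := continuous_gaussMoment τ 1
  have c2 := continuous_gaussMoment τ (gaussDeriv τ 1)
  have cg : Continuous g := by fun_prop
  obtain ⟨C1, hC1, b1⟩ := exists_bound_gaussMoment hτ 1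
  obtain ⟨C2, hC2, b2⟩ := exists_bound_gaussMoment hτ (gaussDeriv τ 1)
  have m1 : MemLp (fun ω => g (S ω)) 2 μ := by
    refine MemLp.of_bound (cg.measurable.comp_aemeasurable hS).aestronglyMeasurable
      (|r| * C1 + C2) (.of_forall fun ω => ?_)
    refine (abs_sub _ _).trans ?_
    rw [abs_mul]
    exact add_le_add (mul_le_mul_of_nonneg_left (b1 _) (abs_nonneg _)) (b2 _)
  have m2 : MemLp (fun ω => gaussMoment τ 1 (y - T ω)) 2 μ := by
    have hm : Measurable fun t => gaussMoment τ 1 (y - t) := by fun_prop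
    exact MemLp.of_bound (hm.comp_aemeasurable hT).aestronglyMeasurable C1
      (.of_forall fun ω => b1 _)
  have lg : ∀ s t, |g s - g t| ≤ L * (1 + |r|) * |s - t| := by
    intro s t
    have e : g s - g t = r * (gaussMoment τ 1 (x - s) - gaussMoment τ 1 (x - t)) -
        (gaussMoment τ (gaussDeriv τ 1) (x - s) - gaussMoment τ (gaussDeriv τ 1) (x - t)) := by
      simp only [hg]; ring
    have e' : |x - s - (x - t)| = |s - t| := by rw [sub_sub_sub_cancel_left, abs_sub_comm]
    have l1 := hL (x - s) (x - t)
    have l2 := hL' (x - s) (x - t)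
    rw [e'] at l1 l2
    rw [e]
    refine (abs_sub _ _).trans ?_
    rw [abs_mul]
    calc _ ≤ |r| * (L * |s - t|) + L * |s - t| := by gcongr
      _ = _ := by ring
  have lk : ∀ s t, |gaussMoment τ 1 (y - s) - gaussMoment τ 1 (y - t)| ≤ L * |s - t| := by
    intro s t
    have l1 := hL (y - s) (y - t)
    rwa [sub_sub_sub_cancel_left, abs_sub_comm t] at l1
  have key := h.fkg.abs_covariance_le h.memLp_S h.memLp_T lg
    (g := fun t => gaussMoment τ 1 (y - t)) lk m1 m2
  have e0 : ∫ ω, g (S ω) ∂μ = 0 := by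
    have := (h.isNoisy_left hτ).integral_score_add x
    simp_rw [← hr, ← hg'] at this
    rwa [integral_map hS cg.aestronglyMeasurable] at this
  rw [covariance_eq_sub m1 m2, e0, zero_mul, sub_zero] at key
  have e1 : ∫ q : ℝ × ℝ, gaussianPDFReal 0 τ (x - q.1) * gaussianPDFReal 0 τ (y - q.2) *
        (r + (x - q.1) / τ) ∂(μ.map fun ω => (S ω, T ω)) =
      ∫ ω, g (S ω) * gaussMoment τ 1 (y - T ω) ∂μ := by
    have hm := measurable_gaussianPDFReal 0 τ
    rw [integral_map (hS.prodMk hT) (by fun_prop)]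
    refine integral_congr_ae (.of_forall fun ω => ?_)
    simp only [hg']
    simp [gaussMoment]
    ring
  rw [e1]
  exact key

/-- The estimate of the correlation of the score of `S + ZS` with a function of the two noisy
variables that vanishes outside of a box. -/
lemma abs_integral_indicator_mul_le (h : IsFKGPairWithNoise S T ZS ZT K τ μ) (hτ : 0 < τ) {L : ℝ}
    (hL0 : 0 ≤ L)
    (hL : ∀ y z, |gaussMoment τ 1 y - gaussMoment τ 1 z| ≤ L * |y - z|)
    (hL' : ∀ y z, |gaussMoment τ (gaussDeriv τ 1) y - gaussMoment τ (gaussDeriv τ 1) z| ≤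
      L * |y - z|) {k : ℝ × ℝ → ℝ} (hk : Measurable k) {B M : ℝ} (hB : 0 ≤ B) (hM0 : 0 ≤ M)
    (hM : ∀ p ∈ Set.Icc (-B) B ×ˢ Set.Icc (-B) B, |k p| ≤ M) :
    |∫ ω, (Set.Icc (-B) B ×ˢ Set.Icc (-B) B).indicator k (S ω + ZS ω, T ω + ZT ω) *
        (score (S + ZS) μ (S ω + ZS ω) + ZS ω / τ) ∂μ| ≤
      M * (L * (1 + (B + √K) / τ) * L * cov[S, T; μ]) * (2 * B) ^ 2 := by
  have hS := h.memLp_S.1.aemeasurable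
  have hT := h.memLp_T.1.aemeasurable
  have hc := h.covariance_nonneg
  have hn := h.isNoisy_left hτ
  have hs := hn.measurable_score
  have hτ' : (0 : ℝ) < τ := hτ
  set Q : Set (ℝ × ℝ) := Set.Icc (-B) B ×ˢ Set.Icc (-B) B with hQ
  have hQm : MeasurableSet Q := measurableSet_Icc.prod measurableSet_Icc
  have hki : Measurable (Q.indicator k) := hk.indicator hQm
  have hφ := measurable_gaussianPDFReal 0 τ
  have i1 : Integrable (fun ω => score (S + ZS) μ (S ω + ZS ω) + ZS ω / τ) μ := by
    refine Integrable.add ?_ ?_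
    · exact hn.hasFiniteFisherInfo.2.integrable (by norm_num)
    · simpa using (hn.integrable_pow_noise 1).div_const (τ : ℝ)
  have i2 : Integrable (fun ω => Q.indicator k (S ω + ZS ω, T ω + ZT ω) *
      (score (S + ZS) μ (S ω + ZS ω) + ZS ω / τ)) μ := by
    refine i1.bdd_mul (c := M) ?_ (.of_forall fun ω => ?_)
    · exact (hki.comp_aemeasurable ((hS.add h.law_ZS.aemeasurable).prodMk
        (hT.add h.law_ZT.aemeasurable))).aestronglyMeasurable
    · rw [Set.indicator_apply]
      split_ifs with hp
      · exact hM _ hp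
      · simpa using hM0
  have e := integral_add_noise (U := fun ω => (S ω, T ω)) (Z := fun ω => (ZS ω, ZT ω))
    (Φ := fun p : ℝ × ℝ => gaussianPDFReal 0 τ p.1 * gaussianPDFReal 0 τ p.2)
    (H := fun q => Q.indicator k q.1 * (score (S + ZS) μ q.1.1 + (q.1.1 - q.2.1) / τ))
    (by fun_prop) (fun p => mul_nonneg (gaussianPDFReal_nonneg _ _ _) (gaussianPDFReal_nonneg _ _ _))
    (hS.prodMk hT) (h.law_noise hτ) h.indep (by fun_prop)
    (by simpa using i2)
  simp only [Prod.mk_add_mk, add_sub_cancel_left, Prod.fst_sub, Prod.snd_sub] at e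
  rw [e]
  -- With the point `p` fixed, `k p` leaves the inner integral. What remains is the covariance just
  -- estimated, to be bounded by its supremum over the box times the area `(2 * B) ^ 2`.
  have e2 : ∀ p : ℝ × ℝ, ∫ q : ℝ × ℝ, gaussianPDFReal 0 τ (p.1 - q.1) *
      gaussianPDFReal 0 τ (p.2 - q.2) * (Q.indicator k p *
        (score (S + ZS) μ p.1 + (p.1 - q.1) / τ)) ∂(μ.map fun ω => (S ω, T ω)) =
      Q.indicator (fun p => k p * ∫ q : ℝ × ℝ, gaussianPDFReal 0 τ (p.1 - q.1) *
      gaussianPDFReal 0 τ (p.2 - q.2) * (score (S + ZS) μ p.1 + (p.1 - q.1) / τ)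
        ∂(μ.map fun ω => (S ω, T ω))) p := by
    intro p
    rw [Set.indicator_apply, Set.indicator_apply]
    split_ifs with hp
    · rw [← integral_const_mul]
      refine integral_congr_ae (.of_forall fun q => ?_)
      simp only
      ring
    · simp
  simp_rw [e2]
  rw [integral_indicator hQm]
  have hvol : (volume : Measure (ℝ × ℝ)).real Q = (2 * B) ^ 2 := by
    rw [hQ, Measure.real, Measure.volume_eq_prod, Measure.prod_prod, Real.volume_Icc,
      ENNReal.toReal_mul, ENNReal.toReal_ofReal (by linarith)]
    ring
  rw [← hvol, ← Real.norm_eq_abs]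
  refine norm_setIntegral_le_of_norm_le_const ?_ fun p hp => ?_
  · rw [hQ, Measure.volume_eq_prod, Measure.prod_prod, Real.volume_Icc]
    exact ENNReal.mul_lt_top ENNReal.ofReal_lt_top ENNReal.ofReal_lt_top
  · rw [Real.norm_eq_abs, abs_mul]
    have hp1 : |p.1| ≤ B := abs_le.2 hp.1
    have := (hn.abs_score_le p.1).trans
      (div_le_div_of_nonneg_right (add_le_add_left hp1 (√K)) hτ'.le)
    refine mul_le_mul (hM p hp)
      ((h.abs_integral_gauss_mul_gauss_le hτ hL hL' p.1 p.2).trans ?_) (abs_nonneg _) hM0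
    gcongr

end IsFKGPairWithNoise

/-! ### Truncation: the contribution outside the box. -/

lemma abs_le_add_pow_div {n : ℕ} (hn : Even n) (hn0 : n ≠ 0) {l : ℝ} (hl : 0 < l) (t : ℝ) :
    |t| ≤ l + t ^ n / l ^ (n - 1) := by
  rcases le_total |t| l with h | h
  · have : 0 ≤ t ^ n / l ^ (n - 1) := div_nonneg (hn.pow_nonneg t) (by positivity)
    linarith
  · obtain ⟨j, rfl⟩ := Nat.exists_eq_succ_of_ne_zero hn0
    have : |t| ≤ t ^ (j + 1) / l ^ j := by
      rw [le_div_iff₀ (by positivity), ← hn.pow_abs, pow_succ, mul_comm]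
      gcongr
    simpa using this.trans (by linarith : _ ≤ l + t ^ (j + 1) / l ^ j)

lemma abs_add_rpow_le {r : ℝ} (hr : 0 ≤ r) (x y : ℝ) :
    |x + y| ^ r ≤ 2 ^ r * (|x| ^ r + |y| ^ r) := by
  have h1 : |x + y| ≤ 2 * max |x| |y| := by
    linarith [abs_add_le x y, le_max_left |x| |y|, le_max_right |x| |y|]
  have h0 : 0 ≤ max |x| |y| := (abs_nonneg x).trans (le_max_left _ _)
  refine (Real.rpow_le_rpow (abs_nonneg _) h1 hr).trans ?_
  rw [Real.mul_rpow (by norm_num) h0]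
  gcongr
  have hx := Real.rpow_nonneg (abs_nonneg x) r
  have hy := Real.rpow_nonneg (abs_nonneg y) r
  rcases max_choice |x| |y| with h | h <;> rw [h] <;> linarith

lemma integrable_abs_rpow_gaussianReal {r : ℝ} (hr : 0 < r) (τ : ℝ≥0) :
    Integrable (fun x : ℝ => |x| ^ r) (gaussianReal 0 τ) := by
  have := (memLp_id_gaussianReal' (μ := 0) (v := τ) (ENNReal.ofReal r) (by simp)).integrable_norm_rpow
    (by simpa using hr) (by simp)
  simpa [ENNReal.toReal_ofReal hr.le] using this

/-- The `n`-th moment of the score of a Gaussian variable. -/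
def noiseMoment (τ : ℝ≥0) (n : ℕ) : ℝ := ∫ x, (x / τ) ^ n ∂(gaussianReal 0 τ)

lemma IsNoisy.integral_noise_pow {Ω : Type*} [MeasurableSpace Ω] {μ : Measure Ω} {U Z : Ω → ℝ}
    {V : ℝ} {τ : ℝ≥0} (h : IsNoisy U Z V τ μ) (n : ℕ) :
    ∫ ω, (Z ω / τ) ^ n ∂μ = noiseMoment τ n :=
  h.law.integral_comp (f := fun x : ℝ => (x / τ) ^ n) (by fun_prop)

lemma IsNoisy.integrable_score_add_pow {Ω : Type*} [MeasurableSpace Ω] {μ : Measure Ω}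
    [IsProbabilityMeasure μ] {U Z : Ω → ℝ}
    {V : ℝ} {τ : ℝ≥0} (h : IsNoisy U Z V τ μ) {n : ℕ} (hn : Even n) (hn0 : n ≠ 0) :
    Integrable (fun ω => (score (U + Z) μ (U ω + Z ω) + Z ω / τ) ^ n) μ ∧
      ∫ ω, (score (U + Z) μ (U ω + Z ω) + Z ω / τ) ^ n ∂μ ≤ 2 ^ n * noiseMoment τ n := by
  obtain ⟨i1, e1⟩ := h.integrable_score_pow hn
  have hX := h.aemeasurable.add h.law.aemeasurable
  have hR : AEMeasurable (fun ω => score (U + Z) μ (U ω + Z ω)) μ :=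
    h.measurable_score.comp_aemeasurable hX
  have hZ := h.law.aemeasurable
  have i2 : Integrable (fun ω => (Z ω / τ) ^ n) μ := by
    simp_rw [div_pow]; exact (h.integrable_pow_noise n).div_const _
  have i3 := (i1.add i2).const_mul (2 ^ (n - 1))
  have pt : ∀ ω, (score (U + Z) μ (U ω + Z ω) + Z ω / τ) ^ n ≤
      2 ^ (n - 1) * (score (U + Z) μ (U ω + Z ω) ^ n + (Z ω / τ) ^ n) := fun ω => hn.add_pow_le
  have i4 : Integrable (fun ω => (score (U + Z) μ (U ω + Z ω) + Z ω / τ) ^ n) μ := by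
    refine i3.mono' (by fun_prop) (.of_forall fun ω => ?_)
    rw [Real.norm_of_nonneg (hn.pow_nonneg _)]
    exact pt ω
  refine ⟨i4, (integral_mono i4 i3 pt).trans ?_⟩
  rw [integral_const_mul, integral_add' i1 i2]
  rw [h.integral_noise_pow] at e1 ⊢
  calc _ ≤ 2 ^ (n - 1) * (noiseMoment τ n + noiseMoment τ n) := by gcongr
    _ = 2 ^ (n - 1 + 1) * noiseMoment τ n := by ring
    _ = _ := by rw [Nat.sub_add_cancel (Nat.one_le_iff_ne_zero.2 hn0)]

lemma integral_abs_add_rpow_le {Ω : Type*} [MeasurableSpace Ω] {μ : Measure Ω}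
    {S Z : Ω → ℝ} {τ : ℝ≥0} (hS : AEMeasurable S μ)
    (hZ : HasLaw Z (gaussianReal 0 τ) μ) {r A : ℝ} (hr : 0 < r)
    (hi : Integrable (fun ω => |S ω| ^ r) μ) (hA : ∫ ω, |S ω| ^ r ∂μ ≤ A) :
    Integrable (fun ω => |S ω + Z ω| ^ r) μ ∧
      ∫ ω, |S ω + Z ω| ^ r ∂μ ≤ 2 ^ r * (A + ∫ x, |x| ^ r ∂(gaussianReal 0 τ)) := by
  have hr0 := hr.le
  have hZm := hZ.aemeasurable
  have iZ : Integrable (fun ω => |Z ω| ^ r) μ := by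
    have h1 := integrable_abs_rpow_gaussianReal hr τ
    rw [← hZ.map_eq] at h1
    exact h1.comp_aemeasurable hZm
  have eZ : ∫ ω, |Z ω| ^ r ∂μ = ∫ x, |x| ^ r ∂(gaussianReal 0 τ) :=
    hZ.integral_comp (f := fun x : ℝ => |x| ^ r) (by fun_prop)
  have i2 := (hi.add iZ).const_mul (2 ^ r)
  have i3 : Integrable (fun ω => |S ω + Z ω| ^ r) μ := by
    refine i2.mono' (by fun_prop) (.of_forall fun ω => ?_)
    rw [Real.norm_of_nonneg (Real.rpow_nonneg (abs_nonneg _) _)]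
    exact abs_add_rpow_le hr.le _ _
  refine ⟨i3, (integral_mono i3 i2 fun ω => abs_add_rpow_le hr.le _ _).trans ?_⟩
  rw [integral_const_mul, integral_add' hi iZ, eZ]
  gcongr

/-- The elementary truncation estimate: outside of the box `[-B, B]²` a bound on the modulus is
traded against moments. -/
lemma abs_indicator_compl_mul_le {k : ℝ × ℝ → ℝ} {n : ℕ} (hn : Even n) (hn0 : n ≠ 0) {B r : ℝ}
    (hB : 0 < B) (hr : 0 < r) (p : ℝ × ℝ) (v : ℝ) :
    |(Set.Icc (-B) B ×ˢ Set.Icc (-B) B)ᶜ.indicator k p * v| ≤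
      B ^ (-(r * (1 - 1 / n))) * (|p.1| ^ r + |p.2| ^ r + ((k p) ^ (2 * n) + v ^ (2 * n))) := by
  have hn' : (n : ℝ) ≠ 0 := Nat.cast_ne_zero.2 hn0
  set E := B ^ (-(r * (1 - 1 / n))) with hE
  have hE0 : 0 ≤ E := by positivity
  have hx := Real.rpow_nonneg (abs_nonneg p.1) r
  have hy := Real.rpow_nonneg (abs_nonneg p.2) r
  have hk : 0 ≤ k p ^ (2 * n) := by rw [pow_mul']; positivity
  have hv : 0 ≤ v ^ (2 * n) := by rw [pow_mul']; positivity
  rw [Set.indicator_apply]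
  split_ifs with hp
  -- A pointwise substitute for Hölder's inequality, based on `|t| ≤ l + t ^ n / l ^ (n - 1)`. This
  -- `l` makes both terms carry the same factor `E`: `l = E * B ^ r`, with `B ^ r` at most the
  -- `r`-th powers of the coordinates outside the box, and `(l ^ (n - 1))⁻¹ = E`.
  · set l := B ^ (r / n) with hl
    have hl0 : 0 < l := by positivity
    have h1 := abs_le_add_pow_div hn hn0 hl0 (k p * v)
    have h2 : B ^ r ≤ |p.1| ^ r + |p.2| ^ r := by
      have : B < |p.1| ∨ B < |p.2| := by
        by_contra! hlt
        exact hp ⟨abs_le.1 hlt.1, abs_le.1 hlt.2⟩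
      rcases this with h | h
      · linarith [Real.rpow_le_rpow hB.le h.le hr.le]
      · linarith [Real.rpow_le_rpow hB.le h.le hr.le]
    have h3 : l = E * B ^ r := by
      rw [hE, hl, ← Real.rpow_add hB]; congr 1; field_simp; ring
    have h4 : (l ^ (n - 1))⁻¹ = E := by
      rw [hE, hl, ← Real.rpow_natCast, ← Real.rpow_mul hB.le, ← Real.rpow_neg hB.le,
        Nat.cast_sub (Nat.one_le_iff_ne_zero.2 hn0)]
      congr 1; field_simp; simp
    have h5 : (k p * v) ^ n ≤ k p ^ (2 * n) + v ^ (2 * n) := by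
      rw [mul_pow, pow_mul', pow_mul']
      nlinarith [sq_nonneg (k p ^ n - v ^ n), sq_nonneg (k p ^ n), sq_nonneg (v ^ n)]
    rw [div_eq_mul_inv, h4] at h1
    calc _ ≤ l + (k p * v) ^ n * E := h1
      _ ≤ E * (|p.1| ^ r + |p.2| ^ r) + (k p ^ (2 * n) + v ^ (2 * n)) * E := by
        rw [h3]; gcongr
      _ = _ := by ring
  · rw [zero_mul, abs_zero]
    positivity

/-- Inside the box the covariance is small; outside, moments are used. Apart from `cov[S, T; μ]`,
the bound involves the law of `(S, T)` only through the uniform data `K`, `A` and `M`. -/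
lemma IsFKGPairWithNoise.abs_integral_mul_le {Ω : Type*} [MeasurableSpace Ω] {μ : Measure Ω}
    [IsProbabilityMeasure μ] {S T ZS ZT : Ω → ℝ} {K : ℝ} {τ : ℝ≥0}
    (h : IsFKGPairWithNoise S T ZS ZT K τ μ) (hτ : 0 < τ) {L : ℝ} (hL0 : 0 ≤ L)
    (hL : ∀ y z, |gaussMoment τ 1 y - gaussMoment τ 1 z| ≤ L * |y - z|)
    (hL' : ∀ y z, |gaussMoment τ (gaussDeriv τ 1) y - gaussMoment τ (gaussDeriv τ 1) z| ≤
      L * |y - z|) {r A : ℝ} (hr : 0 < r)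
    (iS : Integrable (fun ω => |S ω| ^ r) μ) (hS : ∫ ω, |S ω| ^ r ∂μ ≤ A)
    (iT : Integrable (fun ω => |T ω| ^ r) μ) (hT : ∫ ω, |T ω| ^ r ∂μ ≤ A)
    {n : ℕ} (hn : Even n) (hn0 : n ≠ 0)
    {k : ℝ × ℝ → ℝ} (hk : Measurable k) {B M : ℝ} (hB : 0 < B) (hM0 : 0 ≤ M)
    (hM : ∀ x y, |x| ≤ B → |y| ≤ B → |k (x, y)| ≤ M)
    (ik : Integrable (fun ω => k (S ω + ZS ω, T ω + ZT ω) ^ (2 * n)) μ)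
    (hkn : ∫ ω, k (S ω + ZS ω, T ω + ZT ω) ^ (2 * n) ∂μ ≤ 2 ^ (2 * n) * noiseMoment τ (2 * n)) :
    |∫ ω, k (S ω + ZS ω, T ω + ZT ω) * (score (S + ZS) μ (S ω + ZS ω) + ZS ω / τ) ∂μ| ≤
      M * (L * (1 + (B + √K) / τ) * L * cov[S, T; μ]) * (2 * B) ^ 2 +
      B ^ (-(r * (1 - 1 / n))) * (2 * (2 ^ r * (A + ∫ x, |x| ^ r ∂(gaussianReal 0 τ))) +
        2 * (2 ^ (2 * n) * noiseMoment τ (2 * n))) := by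
  have hnoisy := h.isNoisy_left hτ
  have hsm := hnoisy.measurable_score
  have hSm := h.memLp_S.1.aemeasurable
  have hTm := h.memLp_T.1.aemeasurable
  have hZSm := h.law_ZS.aemeasurable
  have hZTm := h.law_ZT.aemeasurable
  have hp : AEMeasurable (fun ω => (S ω + ZS ω, T ω + ZT ω)) μ := by fun_prop
  have hv : AEMeasurable (fun ω => score (S + ZS) μ (S ω + ZS ω) + ZS ω / τ) μ :=
    (hsm.comp_aemeasurable (hSm.add hZSm)).add (hZSm.div_const _)
  set Q : Set (ℝ × ℝ) := Set.Icc (-B) B ×ˢ Set.Icc (-B) B with hQ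
  have hQm : MeasurableSet Q := measurableSet_Icc.prod measurableSet_Icc
  obtain ⟨iX, eX⟩ := integral_abs_add_rpow_le hSm h.law_ZS hr iS hS
  obtain ⟨iY, eY⟩ := integral_abs_add_rpow_le hTm h.law_ZT hr iT hT
  obtain ⟨iv, ev⟩ := hnoisy.integrable_score_add_pow (even_two.mul_right n) (by simpa using hn0)
  have iD := (((iX.add iY).add (ik.add iv)).const_mul (B ^ (-(r * (1 - 1 / n)))))
  have pt : ∀ ω, |Qᶜ.indicator k (S ω + ZS ω, T ω + ZT ω) *
      (score (S + ZS) μ (S ω + ZS ω) + ZS ω / τ)| ≤ _ := fun ω =>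
    abs_indicator_compl_mul_le (k := k) hn hn0 hB hr (S ω + ZS ω, T ω + ZT ω)
      (score (S + ZS) μ (S ω + ZS ω) + ZS ω / τ)
  have i1 : Integrable (fun ω => Qᶜ.indicator k (S ω + ZS ω, T ω + ZT ω) *
      (score (S + ZS) μ (S ω + ZS ω) + ZS ω / τ)) μ := by
    refine iD.mono' ?_ (.of_forall pt)
    exact (((hk.indicator hQm.compl).comp_aemeasurable hp).mul hv).aestronglyMeasurable
  have iv1 : Integrable (fun ω => score (S + ZS) μ (S ω + ZS ω) + ZS ω / τ) μ := by
    refine Integrable.add ?_ ?_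
    · exact hnoisy.hasFiniteFisherInfo.2.integrable (by norm_num)
    · simpa using (hnoisy.integrable_pow_noise 1).div_const (τ : ℝ)
  have hMQ : ∀ p ∈ Q, |k p| ≤ M := fun p hp => hM p.1 p.2 (abs_le.2 hp.1) (abs_le.2 hp.2)
  have i2 : Integrable (fun ω => Q.indicator k (S ω + ZS ω, T ω + ZT ω) *
      (score (S + ZS) μ (S ω + ZS ω) + ZS ω / τ)) μ := by
    refine iv1.bdd_mul (c := M)
      ((hk.indicator hQm).comp_aemeasurable hp).aestronglyMeasurable (.of_forall fun ω => ?_)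
    rw [Set.indicator_apply]
    split_ifs with hp
    · exact hMQ _ hp
    · simpa using hM0
  have e : ∫ ω, k (S ω + ZS ω, T ω + ZT ω) * (score (S + ZS) μ (S ω + ZS ω) + ZS ω / τ) ∂μ =
      ∫ ω, Q.indicator k (S ω + ZS ω, T ω + ZT ω) *
        (score (S + ZS) μ (S ω + ZS ω) + ZS ω / τ) ∂μ +
      ∫ ω, Qᶜ.indicator k (S ω + ZS ω, T ω + ZT ω) *
        (score (S + ZS) μ (S ω + ZS ω) + ZS ω / τ) ∂μ := by
    rw [← integral_add i2 i1]
    refine integral_congr_ae (.of_forall fun ω => ?_)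
    simp only
    rw [← add_mul, Set.indicator_self_add_compl_apply]
  rw [e]
  refine (abs_add_le _ _).trans (add_le_add
    (h.abs_integral_indicator_mul_le hτ hL0 hL hL' hk hB.le hM0 hMQ) ?_)
  refine (abs_integral_le_integral_abs).trans ((integral_mono i1.abs iD pt).trans ?_)
  rw [integral_const_mul, integral_add' (iX.add iY) (ik.add iv), integral_add' iX iY,
    integral_add' ik iv]
  gcongr
  · linarith
  · linarith

/-! ### Expansion of the score gap. -/

lemma integral_sq_expansion {Ω : Type*} [MeasurableSpace Ω] {μ : Measure Ω}
    {RX RY RW ZX ZY : Ω → ℝ} {a b : ℝ} (hX : MemLp RX 2 μ) (hY : MemLp RY 2 μ)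
    (hW : MemLp RW 2 μ) (hZX : MemLp ZX 2 μ) (hZY : MemLp ZY 2 μ)
    (e1 : ∫ ω, RW ω * (RW ω + (a * ZX ω + b * ZY ω)) ∂μ = 0) (e2 : ∫ ω, ZX ω * RY ω ∂μ = 0) :
    ∫ ω, (a * RX ω + b * RY ω - RW ω) ^ 2 ∂μ =
      a ^ 2 * ∫ ω, RX ω ^ 2 ∂μ + b ^ 2 * ∫ ω, RY ω ^ 2 ∂μ - ∫ ω, RW ω ^ 2 ∂μ
      - 2 * a * ∫ ω, (RW ω - b * RY ω) * (RX ω + ZX ω) ∂μ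
      - 2 * b * ∫ ω, RW ω * (RY ω + ZY ω) ∂μ := by
  have iL : Integrable (fun ω => (a * RX ω + b * RY ω - RW ω) ^ 2) μ :=
    (((hX.const_mul a).add (hY.const_mul b)).sub hW).integrable_sq
  have i1 : Integrable (fun ω => (RW ω - b * RY ω) * (RX ω + ZX ω)) μ :=
    (hW.sub (hY.const_mul b)).integrable_mul (hX.add hZX)
  have i2 : Integrable (fun ω => RW ω * (RY ω + ZY ω)) μ := hW.integrable_mul (hY.add hZY)
  have i3 : Integrable (fun ω => RW ω * (RW ω + (a * ZX ω + b * ZY ω))) μ :=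
    hW.integrable_mul (hW.add ((hZX.const_mul a).add (hZY.const_mul b)))
  have i4 : Integrable (fun ω => ZX ω * RY ω) μ := hZX.integrable_mul hY
  have iX := hX.integrable_sq.const_mul (a ^ 2)
  have iY := hY.integrable_sq.const_mul (b ^ 2)
  have iW := hW.integrable_sq
  -- The cross term `RX * RY` is put into the first correlation, at the price of `ZX * RY`, which
  -- has mean zero by `e2`. The term with `RW + (a * ZX + b * ZY)` turns `+RW²` into `-RW²`.
  have pt : ∀ ω, (a * RX ω + b * RY ω - RW ω) ^ 2 = a ^ 2 * RX ω ^ 2 + b ^ 2 * RY ω ^ 2 - RW ω ^ 2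
      - 2 * a * ((RW ω - b * RY ω) * (RX ω + ZX ω)) - 2 * b * (RW ω * (RY ω + ZY ω))
      + 2 * (RW ω * (RW ω + (a * ZX ω + b * ZY ω))) - 2 * a * b * (ZX ω * RY ω) := fun ω => by ring
  simp_rw [pt]
  have j1 : Integrable (fun ω => a ^ 2 * RX ω ^ 2 + b ^ 2 * RY ω ^ 2) μ := iX.add iY
  have j2 : Integrable (fun ω => a ^ 2 * RX ω ^ 2 + b ^ 2 * RY ω ^ 2 - RW ω ^ 2) μ := j1.sub iW
  have j3 : Integrable (fun ω => a ^ 2 * RX ω ^ 2 + b ^ 2 * RY ω ^ 2 - RW ω ^ 2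
      - 2 * a * ((RW ω - b * RY ω) * (RX ω + ZX ω))) μ := j2.sub (i1.const_mul _)
  have j4 : Integrable (fun ω => a ^ 2 * RX ω ^ 2 + b ^ 2 * RY ω ^ 2 - RW ω ^ 2
      - 2 * a * ((RW ω - b * RY ω) * (RX ω + ZX ω)) - 2 * b * (RW ω * (RY ω + ZY ω))) μ :=
    j3.sub (i2.const_mul _)
  have j5 : Integrable (fun ω => a ^ 2 * RX ω ^ 2 + b ^ 2 * RY ω ^ 2 - RW ω ^ 2
      - 2 * a * ((RW ω - b * RY ω) * (RX ω + ZX ω)) - 2 * b * (RW ω * (RY ω + ZY ω))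
      + 2 * (RW ω * (RW ω + (a * ZX ω + b * ZY ω)))) μ := j4.add (i3.const_mul _)
  rw [integral_sub j5 (i4.const_mul _), integral_add j4 (i3.const_mul _),
    integral_sub j3 (i2.const_mul _), integral_sub j2 (i1.const_mul _), integral_sub j1 iW,
    integral_add iX iY]
  simp only [integral_const_mul, e1, e2]
  ring

lemma mix_add {Ω : Type*} (X Y X' Y' : Ω → ℝ) (β : ℝ) :
    mix (X + X') (Y + Y') β =
      (fun ω => √β * X ω + √(1 - β) * Y ω) + fun ω => √β * X' ω + √(1 - β) * Y' ω := by
  funext ω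
  simp only [mix, Pi.add_apply]
  ring

namespace IsFKGPairWithNoise

variable {Ω : Type*} [MeasurableSpace Ω] {μ : Measure Ω} [IsProbabilityMeasure μ]
  {S T ZS ZT : Ω → ℝ} {K : ℝ} {τ : ℝ≥0}

/-- `ZS` is centred and independent of `(T, ZT)`, so Fubini applies, even though `S` and `T` may be
dependent. -/
lemma integral_noise_mul_eq_zero (h : IsFKGPairWithNoise S T ZS ZT K τ μ) {k : ℝ → ℝ}
    (hk : Measurable k) (hi : Integrable (fun ω => ZS ω / τ * k (T ω + ZT ω)) μ) :
    ∫ ω, ZS ω / τ * k (T ω + ZT ω) ∂μ = 0 := by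
  have hU : AEMeasurable (fun ω => (S ω, T ω)) μ :=
    h.memLp_S.1.aemeasurable.prodMk h.memLp_T.1.aemeasurable
  have hZ : AEMeasurable (fun ω => (ZS ω, ZT ω)) μ :=
    h.law_ZS.aemeasurable.prodMk h.law_ZT.aemeasurable
  have hl := (indepFun_iff_map_prod_eq_prod_map_map hU hZ).1 h.indep
  rw [(indepFun_iff_map_prod_eq_prod_map_map h.law_ZS.aemeasurable h.law_ZT.aemeasurable).1
    h.indep_noise, h.law_ZS.map_eq, h.law_ZT.map_eq] at hl
  have := Measure.isProbabilityMeasure_map (μ := μ) hU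
  set H : (ℝ × ℝ) × (ℝ × ℝ) → ℝ := fun p => p.2.1 / τ * k (p.1.2 + p.2.2) with hH
  have hHm : Measurable H := by fun_prop
  have i1 : Integrable H (μ.map fun ω => ((S ω, T ω), (ZS ω, ZT ω))) :=
    (integrable_map_measure hHm.aestronglyMeasurable (hU.prodMk hZ)).2 hi
  have e1 : ∫ ω, ZS ω / τ * k (T ω + ZT ω) ∂μ =
      ∫ p, H p ∂(μ.map fun ω => ((S ω, T ω), (ZS ω, ZT ω))) :=
    (integral_map (hU.prodMk hZ) hHm.aestronglyMeasurable).symm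
  rw [hl] at i1 e1
  rw [e1, integral_prod _ i1]
  refine integral_eq_zero_of_ae (.of_forall fun q => ?_)
  have := integral_prod_mul (μ := gaussianReal 0 τ) (ν := gaussianReal 0 τ)
    (fun x : ℝ => x / τ) (fun y => k (q.2 + y))
  simp only [hH]
  rw [this, integral_div, integral_id_gaussianReal]
  simp

lemma hasFiniteFisherInfo (h : IsFKGPairWithNoise S T ZS ZT K τ μ) (hτ : 0 < τ) {β : ℝ}
    (hβ : β ∈ Set.Icc (0 : ℝ) 1) :
    HasFiniteFisherInfo (S + ZS) μ ∧ HasFiniteFisherInfo (T + ZT) μ ∧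
      HasFiniteFisherInfo (mix (S + ZS) (T + ZT) β) μ := by
  refine ⟨(h.isNoisy_left hτ).hasFiniteFisherInfo, (h.symm.isNoisy_left hτ).hasFiniteFisherInfo, ?_⟩
  rw [mix_add]
  refine (h.isNoisy_mix hτ ?_).hasFiniteFisherInfo
  rw [Real.sq_sqrt hβ.1, Real.sq_sqrt (sub_nonneg.2 hβ.2)]
  ring

/-- The defect of sub-additivity, expressed by the correlations of the scores with the noise. -/
lemma scoreGap_eq (h : IsFKGPairWithNoise S T ZS ZT K τ μ) (hτ : 0 < τ) {β : ℝ}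
    (hβ : β ∈ Set.Icc (0 : ℝ) 1) :
    scoreGap (S + ZS) (T + ZT) β μ =
      β * fisherInfo (S + ZS) μ + (1 - β) * fisherInfo (T + ZT) μ
        - fisherInfo (mix (S + ZS) (T + ZT) β) μ
      - 2 * √β * ∫ ω, (score (mix (S + ZS) (T + ZT) β) μ (√β * (S ω + ZS ω) +
            √(1 - β) * (T ω + ZT ω)) - √(1 - β) * score (T + ZT) μ (T ω + ZT ω)) *
          (score (S + ZS) μ (S ω + ZS ω) + ZS ω / τ) ∂μ
      - 2 * √(1 - β) * ∫ ω, score (mix (S + ZS) (T + ZT) β) μ (√β * (S ω + ZS ω) +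
            √(1 - β) * (T ω + ZT ω)) * (score (T + ZT) μ (T ω + ZT ω) + ZT ω / τ) ∂μ := by
  have hab : √β ^ 2 + √(1 - β) ^ 2 = 1 := by
    rw [Real.sq_sqrt hβ.1, Real.sq_sqrt (sub_nonneg.2 hβ.2)]
    ring
  obtain ⟨⟨-, hX⟩, ⟨-, hY⟩, ⟨-, hW⟩⟩ := h.hasFiniteFisherInfo hτ hβ
  have hZ : ∀ {S T ZS ZT : Ω → ℝ}, IsFKGPairWithNoise S T ZS ZT K τ μ →
      MemLp (fun ω => ZS ω / τ) 2 μ := fun {S T ZS ZT} h => by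
    have hm := h.law_ZS.aemeasurable
    refine (memLp_two_iff_integrable_sq (by fun_prop)).2 ?_
    simp_rw [div_pow]
    exact ((h.isNoisy_left hτ).integrable_pow_noise 2).div_const _
  have hZS := hZ h
  have hZT := hZ h.symm
  have hn := h.isNoisy_mix hτ hab
  have hmix : ∀ ω, √β * S ω + √(1 - β) * T ω + (√β * ZS ω + √(1 - β) * ZT ω) =
      mix (S + ZS) (T + ZT) β ω := fun ω => by simp only [mix, Pi.add_apply]; ring
  have e1 : ∫ ω, score (mix (S + ZS) (T + ZT) β) μ (mix (S + ZS) (T + ZT) β ω) *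
      (score (mix (S + ZS) (T + ZT) β) μ (mix (S + ZS) (T + ZT) β ω) +
        (√β * (ZS ω / τ) + √(1 - β) * (ZT ω / τ))) ∂μ = 0 := by
    have hms := hn.measurable_score
    have key := hn.integral_mul_score_add hms
    rw [← mix_add] at key
    simp only [hmix, add_div, mul_div_assoc] at key
    exact key (hW.integrable_mul (hW.add ((hZS.const_mul _).add (hZT.const_mul _))))
  have e2 : ∫ ω, ZS ω / τ * score (T + ZT) μ ((T + ZT) ω) ∂μ = 0 :=
    h.integral_noise_mul_eq_zero (h.symm.isNoisy_left hτ).measurable_score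
      (hZS.integrable_mul hY)
  have := integral_sq_expansion hX hY hW hZS hZT e1 e2
  rw [Real.sq_sqrt hβ.1, Real.sq_sqrt (sub_nonneg.2 hβ.2)] at this
  exact this

end IsFKGPairWithNoise

/-! ### Choice of the truncation level and assembly. -/

/-- Optimization of the truncation level. -/
lemma le_mul_rpow_of_forall_truncation {D c K C₁ C₂ r ε : ℝ} {n : ℕ} (hC₁ : 0 ≤ C₁) (hC₂ : 0 ≤ C₂)
    (hr : 0 < r) (hn : 2 ≤ n) (hnε : 1 / (n : ℝ) ≤ ε) (hc : 0 ≤ c) (hcK : c ≤ K)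
    (hD : ∀ B : ℝ, 0 < B → D ≤ C₁ * (1 + B) ^ 4 * c + B ^ (-(r * (1 - 1 / n))) * C₂) :
    D ≤ (C₁ * (K ^ (1 / (4 + r)) + 1) ^ 4 * K ^ ε + K ^ (ε - r / (4 + r) / n) * C₂) *
      c ^ (r / (4 + r) - ε) := by
  have hn' : (2 : ℝ) ≤ n := by exact_mod_cast hn
  have hK : 0 ≤ K := hc.trans hcK
  have he : 0 < r * (1 - 1 / (n : ℝ)) := by
    refine mul_pos hr (sub_pos.2 ?_)
    rw [div_lt_one (by linarith)]
    linarith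
  -- For zero covariance, `B → ∞` gives `D ≤ 0`. The right side is nonnegative whatever value the
  -- power of `0` takes.
  rcases hc.eq_or_lt with rfl | hc
  · have hD0 : D ≤ 0 := by
      have ht := (tendsto_rpow_neg_atTop he).mul_const C₂
      rw [zero_mul] at ht
      refine ge_of_tendsto ht ?_
      filter_upwards [Filter.eventually_gt_atTop 0] with B hB
      simpa using hD B hB
    refine hD0.trans (mul_nonneg ?_ (Real.rpow_nonneg le_rfl _))
    positivity
  · have hK' : 0 < K := hc.trans_le hcK
    set s := 1 / (4 + r) with hs
    have hs0 : 0 < s := by positivity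
    have hrs : r / (4 + r) = r * s := by rw [hs]; ring
    have h4s : 4 * s = 1 - r * s := by rw [hs]; field_simp; ring
    -- This level balances the two contributions: `B ^ 4 * c` and `B ^ (-r)` both equal `c ^ (r *
    -- s)`. The deficit `1 / n` in the tail exponent costs `r * s / n ≤ ε`.
    set B := c ^ (-s) with hBdef
    have hB : 0 < B := by positivity
    -- Since `c ≤ K`, surplus powers of `c` are absorbed into powers of `K`.
    have hpow : ∀ t : ℝ, r * s - ε ≤ t → c ^ t ≤ K ^ (t - (r * s - ε)) * c ^ (r * s - ε) := by
      intro t ht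
      have : c ^ t = c ^ (t - (r * s - ε)) * c ^ (r * s - ε) := by
        rw [← Real.rpow_add hc]; congr 1; ring
      rw [this]
      gcongr
    have hε : 0 ≤ ε := le_trans (by positivity) hnε
    have b1 : (1 + B) ^ 4 * c ≤ (K ^ s + 1) ^ 4 * (K ^ ε * c ^ (r * s - ε)) := by
      -- Again by `c ≤ K`, `B` is bounded below, so `1 + B` is at most a constant multiple of `B`.
      have h1 : 1 ≤ K ^ s * B := by
        rw [hBdef, Real.rpow_neg hc.le, ← div_eq_mul_inv, one_le_div (by positivity)]
        gcongr
      have h2 : 1 + B ≤ (K ^ s + 1) * B := by linarith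
      have h3 : B ^ 4 * c = c ^ (r * s) := by
        rw [hBdef, ← Real.rpow_natCast, ← Real.rpow_mul hc.le]
        nth_rewrite 2 [← Real.rpow_one c]
        rw [← Real.rpow_add hc]
        congr 1
        push_cast
        linarith
      calc (1 + B) ^ 4 * c ≤ ((K ^ s + 1) * B) ^ 4 * c := by gcongr
        _ = (K ^ s + 1) ^ 4 * c ^ (r * s) := by rw [← h3]; ring
        _ ≤ _ := by
          gcongr
          refine (hpow _ (by linarith)).trans_eq ?_
          congr 2; ring
    have b2 : B ^ (-(r * (1 - 1 / (n : ℝ)))) ≤ K ^ (ε - r * s / n) * c ^ (r * s - ε) := by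
      have h1 : B ^ (-(r * (1 - 1 / (n : ℝ)))) = c ^ (r * s - r * s / n) := by
        rw [hBdef, ← Real.rpow_mul hc.le]
        congr 1
        ring
      have h2 : r * s / n ≤ ε := by
        refine le_trans ?_ hnε
        gcongr
        linarith
      rw [h1]
      refine (hpow _ (by linarith)).trans_eq ?_
      congr 2; ring
    rw [hrs]
    calc D ≤ C₁ * ((1 + B) ^ 4 * c) + B ^ (-(r * (1 - 1 / (n : ℝ)))) * C₂ := by
          rw [← mul_assoc]; exact hD B hB
      _ ≤ C₁ * ((K ^ s + 1) ^ 4 * (K ^ ε * c ^ (r * s - ε))) +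
          (K ^ (ε - r * s / n) * c ^ (r * s - ε)) * C₂ := by gcongr
      _ = _ := by ring

lemma neg_two_mul_mul_le {a I R : ℝ} (ha0 : 0 ≤ a) (ha1 : a ≤ 1) (h : |I| ≤ R) :
    -2 * a * I ≤ 2 * R := by
  have h1 : a * |I| ≤ 1 * R := mul_le_mul ha1 h (abs_nonneg I) zero_le_one
  have h2 := mul_le_mul_of_nonneg_left (neg_abs_le I) ha0
  linarith

/-- The factor `4` accounts for two correlations, each with a coefficient of modulus at most `2`.
The four factors `1 + B` come from the bound on `k`, the Lipschitz constant and the area. -/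
lemma box_bound_le {τ B L c : ℝ} (hτ : 0 < τ) (p q : ℝ) (hp : 0 ≤ p) (hq : 0 ≤ q) (hB : 0 ≤ B)
    (hL : 0 ≤ L) (hc : 0 ≤ c) :
    4 * ((3 * B + p + q) / τ * (L * (1 + (B + q) / τ) * L * c) * (2 * B) ^ 2) ≤
      16 * L ^ 2 * ((3 + p + q) / τ) * (1 + (1 + q) / τ) * (1 + B) ^ 4 * c := by
  have g₁ : (3 * B + p + q) / τ ≤ (3 + p + q) / τ * (1 + B) := by
    rw [div_mul_eq_mul_div]
    gcongr
    nlinarith [mul_nonneg hp hB, mul_nonneg hq hB]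
  have g₂ : 1 + (B + q) / τ ≤ (1 + (1 + q) / τ) * (1 + B) := by
    have : B + q ≤ (1 + q) * (1 + B) := by nlinarith [mul_nonneg hq hB]
    calc 1 + (B + q) / τ ≤ 1 * (1 + B) + (1 + q) * (1 + B) / τ := by gcongr; linarith
      _ = _ := by ring
  have g₃ : (2 * B) ^ 2 ≤ 4 * (1 + B) ^ 2 := by nlinarith
  calc _ ≤ 4 * (((3 + p + q) / τ * (1 + B)) * (L * ((1 + (1 + q) / τ) * (1 + B)) * L * c) *
        (4 * (1 + B) ^ 2)) := by gcongr
    _ = _ := by ring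

/-- The defect of sub-additivity is controlled by a power of the covariance, under a bound on the
moments of order `r`. -/
theorem exists_scoreGap_le (K : ℝ) (τ : ℝ≥0) (hτ : 0 < τ) {r ε A : ℝ} (hr : 0 < r) (hε : 0 < ε) :
    ∃ C : ℝ, ∀ (Ω : Type u) [MeasurableSpace Ω] (μ : Measure Ω) [IsProbabilityMeasure μ]
      (S T ZS ZT : Ω → ℝ), IsFKGPairWithNoise S T ZS ZT K τ μ →
      Integrable (fun ω => |S ω| ^ r) μ → ∫ ω, |S ω| ^ r ∂μ ≤ A →
      Integrable (fun ω => |T ω| ^ r) μ → ∫ ω, |T ω| ^ r ∂μ ≤ A →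
      ∀ β ∈ Set.Icc (0 : ℝ) 1,
        scoreGap (S + ZS) (T + ZT) β μ ≤
          β * fisherInfo (S + ZS) μ + (1 - β) * fisherInfo (T + ZT) μ
            - fisherInfo (mix (S + ZS) (T + ZT) β) μ + C * cov[S, T; μ] ^ (r / (4 + r) - ε) := by
  have hτ' : (0 : ℝ) < τ := hτ
  obtain ⟨L₁, hL₁, l₁⟩ := exists_lipschitz_gaussMoment hτ 1
  obtain ⟨L₂, hL₂, l₂⟩ := exists_lipschitz_gaussMoment hτ (gaussDeriv τ 1)
  set L := max L₁ L₂
  have hL0 : 0 ≤ L := hL₁.trans (le_max_left _ _)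
  have hL : ∀ y z, |gaussMoment τ 1 y - gaussMoment τ 1 z| ≤ L * |y - z| := fun y z =>
    (l₁ y z).trans (mul_le_mul_of_nonneg_right (le_max_left _ _) (abs_nonneg _))
  have hL' : ∀ y z, |gaussMoment τ (gaussDeriv τ 1) y - gaussMoment τ (gaussDeriv τ 1) z| ≤
      L * |y - z| := fun y z =>
    (l₂ y z).trans (mul_le_mul_of_nonneg_right (le_max_right _ _) (abs_nonneg _))
  -- Even, so that powers are convex and nonnegative, and large enough that `1 / n ≤ ε`.
  set n := 2 * (⌈1 / ε⌉₊ + 1) with hn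
  have hne : Even n := even_two_mul _
  have hn2 : 2 ≤ n := by omega
  have hn0 : n ≠ 0 := by omega
  have hnε : 1 / (n : ℝ) ≤ ε := by
    have h1 := Nat.le_ceil (1 / ε)
    rw [one_div_le (by positivity) hε, hn]
    push_cast
    have : (0 : ℝ) ≤ ⌈1 / ε⌉₊ := by positivity
    linarith
  set C₁ := 16 * L ^ 2 * ((3 + √(2 * K) + √K) / τ) * (1 + (1 + √K) / τ) with hC₁
  set C₃ := 2 * (2 ^ r * (A + ∫ x, |x| ^ r ∂(gaussianReal 0 τ))) +
        2 * (2 ^ (2 * n) * noiseMoment τ (2 * n)) with hC₃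
  refine ⟨C₁ * (K ^ (1 / (4 + r)) + 1) ^ 4 * K ^ ε + K ^ (ε - r / (4 + r) / n) * (4 * C₃), ?_⟩
  intro Ω _ μ _ S T ZS ZT h iS hS iT hT β hβ
  have hc := h.covariance_nonneg
  have hA : 0 ≤ A := (integral_nonneg fun ω => Real.rpow_nonneg (abs_nonneg _) r).trans hS
  have he2 : Even (2 * n) := even_two_mul n
  have hN0 : 0 ≤ noiseMoment τ (2 * n) := integral_nonneg fun x => he2.pow_nonneg _
  have hG0 : 0 ≤ ∫ x, |x| ^ r ∂(gaussianReal 0 τ) :=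
    integral_nonneg fun x => Real.rpow_nonneg (abs_nonneg _) r
  have hC₃0 : 0 ≤ C₃ := by positivity
  have hC₁0 : 0 ≤ C₁ := by positivity
  set a := √β with ha
  set b := √(1 - β) with hb
  have ha0 : 0 ≤ a := Real.sqrt_nonneg _
  have hb0 : 0 ≤ b := Real.sqrt_nonneg _
  have ha1 : a ≤ 1 := Real.sqrt_le_one.2 hβ.2
  have hb1 : b ≤ 1 := Real.sqrt_le_one.2 (by linarith [hβ.1])
  have hab : a ^ 2 + b ^ 2 = 1 := by
    rw [ha, hb, Real.sq_sqrt hβ.1, Real.sq_sqrt (sub_nonneg.2 hβ.2)]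
    ring
  have nY := h.symm.isNoisy_left hτ
  have nW := h.isNoisy_mix hτ hab
  have mY := nY.measurable_score
  have mW := nW.measurable_score
  have bW := nW.abs_score_le
  obtain ⟨iW, eW⟩ := nW.integrable_score_pow he2
  rw [nW.integral_noise_pow] at eW
  obtain ⟨iY, eY⟩ := nY.integrable_score_pow he2
  rw [nY.integral_noise_pow] at eY
  have hmix : ∀ ω, a * S ω + b * T ω + (a * ZS ω + b * ZT ω) =
      a * (S ω + ZS ω) + b * (T ω + ZT ω) := fun ω => by ring
  simp only [hmix] at iW eW
  rw [ha, hb, ← mix_add] at mW bW iW eW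
  rw [← ha, ← hb] at iW eW
  set ρ := score (mix (S + ZS) (T + ZT) β) μ with hρ
  have hgap := h.scoreGap_eq hτ hβ
  rw [← ha, ← hb, ← hρ] at hgap
  rw [hgap]
  set I₁ := ∫ ω, (ρ (a * (S ω + ZS ω) + b * (T ω + ZT ω)) - b * score (T + ZT) μ (T ω + ZT ω)) *
          (score (S + ZS) μ (S ω + ZS ω) + ZS ω / τ) ∂μ with hI₁
  set I₂ := ∫ ω, ρ (a * (S ω + ZS ω) + b * (T ω + ZT ω)) *
      (score (T + ZT) μ (T ω + ZT ω) + ZT ω / τ) ∂μ with hI₂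
  have h2n : 1 ≤ 2 * n := by omega
  -- the two correlations, for each truncation level
  have key : ∀ B : ℝ, 0 < B → -2 * a * I₁ - 2 * b * I₂ ≤
      C₁ * (1 + B) ^ 4 * cov[S, T; μ] + B ^ (-(r * (1 - 1 / n))) * (4 * C₃) := by
    intro B hB
    -- On the box `|a x + b y| ≤ 2 B`, so the score of the mixture is at most `(2 * B + √(2 * K)) /
    -- τ`, and that of `Y` at most `(B + √K) / τ`. `M` is their sum.
    set M := (3 * B + √(2 * K) + √K) / τ with hM
    have hM0 : 0 ≤ M := by positivity
    have bρ : ∀ x y, |x| ≤ B → |y| ≤ B → |ρ (a * x + b * y)| ≤ (2 * B + √(2 * K)) / τ := by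
      intro x y hx hy
      refine (bW _).trans ?_
      gcongr
      calc |a * x + b * y| ≤ a * |x| + b * |y| := by
            refine (abs_add_le _ _).trans_eq ?_
            rw [abs_mul, abs_mul, abs_of_nonneg ha0, abs_of_nonneg hb0]
        _ ≤ 1 * B + 1 * B := by gcongr
        _ = 2 * B := by ring
    have hk₁ : ∀ x y, |x| ≤ B → |y| ≤ B → |ρ (a * x + b * y) - b * score (T + ZT) μ y| ≤ M := by
      intro x y hx hy
      have h1 : |b * score (T + ZT) μ y| ≤ (B + √K) / τ := by
        rw [abs_mul, abs_of_nonneg hb0]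
        calc b * |score (T + ZT) μ y| ≤ 1 * ((B + √K) / τ) := by
              gcongr
              exact (nY.abs_score_le y).trans (by gcongr)
          _ = _ := one_mul _
      calc _ ≤ (2 * B + √(2 * K)) / τ + (B + √K) / τ :=
            (abs_sub _ _).trans (add_le_add (bρ x y hx hy) h1)
        _ = M := by rw [hM]; ring
    have hk₂ : ∀ y x, |y| ≤ B → |x| ≤ B → |ρ (a * x + b * y)| ≤ M := by
      intro y x hy hx
      refine (bρ x y hx hy).trans ?_
      exact div_le_div_of_nonneg_right (by linarith [Real.sqrt_nonneg K]) hτ'.le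
    have pt : ∀ ω, (ρ (a * (S ω + ZS ω) + b * (T ω + ZT ω)) -
        b * score (T + ZT) μ (T ω + ZT ω)) ^ (2 * n) ≤
        2 ^ (2 * n - 1) * (ρ (a * (S ω + ZS ω) + b * (T ω + ZT ω)) ^ (2 * n) +
          score (T + ZT) μ (T ω + ZT ω) ^ (2 * n)) := by
      intro ω
      have h1 := he2.add_pow_le (a := ρ (a * (S ω + ZS ω) + b * (T ω + ZT ω)))
        (b := -(b * score (T + ZT) μ (T ω + ZT ω)))
      rw [← sub_eq_add_neg, he2.neg_pow, mul_pow] at h1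
      refine h1.trans ?_
      gcongr
      exact mul_le_of_le_one_left (he2.pow_nonneg _) (pow_le_one₀ hb0 hb1)
    have hSm := h.memLp_S.1.aemeasurable
    have hTm := h.memLp_T.1.aemeasurable
    have hZSm := h.law_ZS.aemeasurable
    have hZTm := h.law_ZT.aemeasurable
    have i3 := (iW.add iY).const_mul (2 ^ (2 * n - 1))
    have i4 : Integrable (fun ω => (ρ (a * (S ω + ZS ω) + b * (T ω + ZT ω)) -
        b * score (T + ZT) μ (T ω + ZT ω)) ^ (2 * n)) μ := by
      refine i3.mono' ?_ (.of_forall fun ω => ?_)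
      · have m1 : Measurable fun p : ℝ × ℝ =>
          (ρ (a * p.1 + b * p.2) - b * score (T + ZT) μ p.2) ^ (2 * n) := by fun_prop
        exact (m1.comp_aemeasurable ((hSm.add hZSm).prodMk (hTm.add hZTm))).aestronglyMeasurable
      · rw [Real.norm_of_nonneg (he2.pow_nonneg _)]
        exact pt ω
    have e4 : ∫ ω, (ρ (a * (S ω + ZS ω) + b * (T ω + ZT ω)) -
        b * score (T + ZT) μ (T ω + ZT ω)) ^ (2 * n) ∂μ ≤
        2 ^ (2 * n) * noiseMoment τ (2 * n) := by
      refine (integral_mono i4 i3 pt).trans ?_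
      rw [integral_const_mul, integral_add' iW iY]
      calc _ ≤ 2 ^ (2 * n - 1) * (noiseMoment τ (2 * n) + noiseMoment τ (2 * n)) := by gcongr
        _ = 2 ^ (2 * n - 1 + 1) * noiseMoment τ (2 * n) := by ring
        _ = _ := by rw [Nat.sub_add_cancel h2n]
    have e5 : ∫ ω, ρ (a * (S ω + ZS ω) + b * (T ω + ZT ω)) ^ (2 * n) ∂μ ≤
        2 ^ (2 * n) * noiseMoment τ (2 * n) :=
      eW.trans (le_mul_of_one_le_left hN0 (one_le_pow₀ one_le_two))
    have bd₁ := h.abs_integral_mul_le hτ hL0 hL hL' hr iS hS iT hT hne hn0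
      (k := fun p => ρ (a * p.1 + b * p.2) - b * score (T + ZT) μ p.2) (by fun_prop) hB hM0 hk₁ i4 e4
    -- The roles of `S` and `T` are exchanged, hence the swapped coordinates in `k`.
    have bd₂ := h.symm.abs_integral_mul_le hτ hL0 hL hL' hr iT hT iS hS hne hn0
      (k := fun p => ρ (a * p.2 + b * p.1)) (by fun_prop) hB hM0 hk₂ iW e5
    rw [covariance_comm T S, ← hC₃] at bd₂
    rw [← hC₃] at bd₁
    set E := B ^ (-(r * (1 - 1 / (n : ℝ))))
    set c := cov[S, T; μ]
    set R := M * (L * (1 + (B + √K) / τ) * L * c) * (2 * B) ^ 2 + E * C₃ with hR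
    have f₁ := neg_two_mul_mul_le ha0 ha1 bd₁
    have f₂ := neg_two_mul_mul_le hb0 hb1 bd₂
    have g := box_bound_le hτ' (√(2 * K)) (√K) (Real.sqrt_nonneg _) (Real.sqrt_nonneg _) hB.le hL0 hc
    calc -2 * a * I₁ - 2 * b * I₂ ≤ 4 * R := by linarith
      _ ≤ C₁ * (1 + B) ^ 4 * c + E * (4 * C₃) := by
          rw [hR, hC₁]
          linarith
  have fin := le_mul_rpow_of_forall_truncation hC₁0 (by positivity : 0 ≤ 4 * C₃) hr hn2 hnε hc
    h.covariance_le key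
  linarith

end FKGFisher

end

theorem theorem2p2 (K : ℝ) (τ : ℝ≥0) (hτ : 0 < τ) :
    -- all the quantities in the inequalities below are well defined and finite
    (∀ (Ω : Type u) [MeasurableSpace Ω] (μ : Measure Ω) [IsProbabilityMeasure μ]
      (S T ZS ZT : Ω → ℝ), FKGFisher.IsFKGPairWithNoise S T ZS ZT K τ μ →
      ∀ β ∈ Set.Icc (0 : ℝ) 1,
        FKGFisher.HasFiniteFisherInfo (S + ZS) μ ∧
        FKGFisher.HasFiniteFisherInfo (T + ZT) μ ∧
        FKGFisher.HasFiniteFisherInfo (FKGFisher.mix (S + ZS) (T + ZT) β) μ) ∧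
    -- almost sub-additivity of the Fisher information
    (∀ ε : ℝ, 0 < ε → ∃ C : ℝ,
      ∀ (Ω : Type u) [MeasurableSpace Ω] (μ : Measure Ω) [IsProbabilityMeasure μ]
        (S T ZS ZT : Ω → ℝ), FKGFisher.IsFKGPairWithNoise S T ZS ZT K τ μ →
        ∀ β ∈ Set.Icc (0 : ℝ) 1,
          FKGFisher.scoreGap (S + ZS) (T + ZT) β μ ≤
            β * FKGFisher.fisherInfo (S + ZS) μ + (1 - β) * FKGFisher.fisherInfo (T + ZT) μ
              - FKGFisher.fisherInfo (FKGFisher.mix (S + ZS) (T + ZT) β) μ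
              + C * cov[S, T; μ] ^ (1 / 3 - ε)) ∧
    -- the improved exponent if the moments of order `2 + δ` are at most `L`
    (∀ ε δ L : ℝ, 0 < ε → 0 < δ → ∃ C : ℝ,
      ∀ (Ω : Type u) [MeasurableSpace Ω] (μ : Measure Ω) [IsProbabilityMeasure μ]
        (S T ZS ZT : Ω → ℝ), FKGFisher.IsFKGPairWithNoise S T ZS ZT K τ μ →
        Integrable (fun ω => |S ω| ^ (2 + δ)) μ → ∫ ω, |S ω| ^ (2 + δ) ∂μ ≤ L →
        Integrable (fun ω => |T ω| ^ (2 + δ)) μ → ∫ ω, |T ω| ^ (2 + δ) ∂μ ≤ L →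
        ∀ β ∈ Set.Icc (0 : ℝ) 1,
          FKGFisher.scoreGap (S + ZS) (T + ZT) β μ ≤
            β * FKGFisher.fisherInfo (S + ZS) μ + (1 - β) * FKGFisher.fisherInfo (T + ZT) μ
              - FKGFisher.fisherInfo (FKGFisher.mix (S + ZS) (T + ZT) β) μ
              + C * cov[S, T; μ] ^ ((2 + δ) / (6 + δ) - ε)) := by
  refine ⟨fun Ω _ μ _ S T ZS ZT h β hβ => h.hasFiniteFisherInfo hτ hβ, fun ε hε => ?_,
    fun ε δ L hε hδ => ?_⟩
  -- The variance bound is itself a moment bound of order `r = 2` with `A = K`, and `r / (4 + r) = 1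
  -- / 3`.
  · obtain ⟨C, hC⟩ := FKGFisher.exists_scoreGap_le.{u} K τ hτ (r := 2) (A := K) two_pos hε
    refine ⟨C, fun Ω _ μ _ S T ZS ZT h β hβ => ?_⟩
    have := hC Ω μ S T ZS ZT h
    simp only [Real.rpow_two, sq_abs] at this
    have := this h.memLp_S.integrable_sq h.integral_sq_le h.memLp_T.integrable_sq
      h.symm.integral_sq_le β hβ
    rwa [show (2 : ℝ) / (4 + 2) = 1 / 3 by norm_num] at this
  · obtain ⟨C, hC⟩ := FKGFisher.exists_scoreGap_le.{u} K τ hτ (r := 2 + δ) (A := L)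
      (by linarith) hε
    rw [show 4 + (2 + δ) = 6 + δ by ring] at hC
    exact ⟨C, hC⟩
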